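/- Let $\mathbb{R}/(L\mathbb{Z})$ be the circle of length $L>0$. For a closed curve $\gamma:\mathbb{R}/\mathbb{Z}\to\mathbb{R}^3$ that is Lipschitz continuous, let $\mathscr{L}(\gamma)=\int_0^1|\gamma'|$ be its length, let $d_\gamma(x,y)$ be the intrinsic distance, i.e. the length of the shorter of the two arcs of $\gamma$ between the parameters $x$ and $y$, and let $$E_\alpha(\gamma)=\int_{\mathbb{R}/\mathbb{Z}}\int_{-1/2}^{1/2}\left(\frac{1}{|\gamma(u+w)-\gamma(u)|^\alpha}-\frac{1}{d_\gamma(u+w,u)^\alpha}\right)|\gamma'(u+w)|\,|\gamma'(u)|\,dw\,du\in[0,\infty]$$ be O'Hara's energy. For $s\in(0,1)$ and $f:\mathbb{R}/(L\mathbb{Z})\to\mathbb{R}^3$ let $$[f]_{s,2}=\left(\int_{\mathbb{R}/(L\mathbb{Z})}\int_{-L/2}^{L/2}\frac{|f(u+w)-f(u)|^2}{|w|^{1+2s}}\,dw\,du\right)^{1/2},$$ and let $W^{1+s,2}(\mathbb{R}/(L\mathbb{Z}),\mathbb{R}^3)$ be the space of $f\in L^2$ with weak derivative $f'\in L^2$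 and $[f']_{s,2}<\infty$. For $\alpha\in[2,3)$ the following holds. (i) Let $\gamma:\mathbb{R}/\mathbb{Z}\to\mathbb{R}^3$ be Lipschitz continuous with $|\gamma'|>0$ almost everywhere and $E_\alpha(\gamma)<\infty$, and let $L=\mathscr{L}(\gamma)>0$. Then $\gamma|_{[0,1)}$ is injective, and its arclength parametrization $\Gamma:\mathbb{R}/(L\mathbb{Z})\to\mathbb{R}^3$, determined by $\Gamma\big(\int_0^t|\gamma'|\big)=\gamma(t)$ for all $t$, is $1$-Lipschitz with $|\Gamma'|=1$ almost everywhere, is of class $W^{(\alpha+1)/2,2}(\mathbb{R}/(L\mathbb{Z}),\mathbb{R}^3)$, and satisfies $$[\Gamma']^2_{(\alpha-1)/2,2}\le 4^3\cdot 2^{2-\alpha}\,E_\alpha(\gamma).$$ (ii) Conversely, let $\alpha\in(2,3)$ and let $\gamma\in W^{(\alpha+1)/2,2}(\mathbb{R}/\mathbb{Z},\mathbb{R}^3)$ (represented by its continuous, hence $C^1$, representative) be regular, i.e. $|\gamma'|>0$ everywhere on $\mathbb{R}/\mathbb{Z}$, with $\gamma|_{[0,1)}$ injective. Then $E_\alpha(\gamma)<\infty$.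 -/

import Mathlib

open MeasureTheory
open scoped ENNReal ContDiff

/-- Euclidean three-space. -/
abbrev E3 : Type := EuclideanSpace ℝ (Fin 3)

/-! Maps on `ℝ/(Lℤ)` are represented by `L`-periodic maps on `ℝ`, and integration over
`ℝ/(Lℤ)` by integration over the fundamental domain `(0, L]`. -/

/-- The arclength `∫_a^b |γ'(τ)| dτ` of the arc of `γ` between the parameters `a` and `b`
(signed: negative if `b < a`). For absolutely continuous curves and `a ≤ b` it is the length
of `γ` restricted to `[a, b]`. -/
noncomputable def arclength (γ : ℝ → E3) (a b : ℝ) : ℝ :=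
  ∫ τ in a..b, ‖deriv γ τ‖

/-- The length of a closed curve `γ : ℝ/(Lℤ) → ℝ³`. -/
noncomputable def curveLength (L : ℝ) (γ : ℝ → E3) : ℝ :=
  arclength γ 0 L

/-- The intrinsic distance of `γ(x)` and `γ(y)` for parameters with `|x - y| ≤ L`, that is, the
length of the shorter one of the two arcs of the closed curve `γ : ℝ/(Lℤ) → ℝ³` between them. -/
noncomputable def intrinsicDist (L : ℝ) (γ : ℝ → E3) (x y : ℝ) : ℝ :=
  min |arclength γ y x| (curveLength L γ - |arclength γ y x|)

/-- O'Hara's energy of a closed curve `γ : ℝ/(Lℤ) → ℝ³`, with values in `[0, ∞]`. The first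
fraction is `∞` where `γ(u+w) = γ(u)`; the difference is never truncated for absolutely
continuous curves, since chords are not longer than arcs. -/
noncomputable def oharaEnergy (L α : ℝ) (γ : ℝ → E3) : ℝ≥0∞ :=
  ∫⁻ u in Set.Ioc 0 L, ∫⁻ w in Set.Icc (-L / 2) (L / 2),
    (1 / ‖γ (u + w) - γ u‖ₑ ^ α - 1 / ENNReal.ofReal (intrinsicDist L γ (u + w) u) ^ α)
      * ‖deriv γ (u + w)‖ₑ * ‖deriv γ u‖ₑ

/-- The arclength parametrization `Γ = γ ∘ σ⁻¹` of `γ`, where `σ(t) = ∫_0^t |γ'(τ)| dτ`. -/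
noncomputable def arclengthParam (γ : ℝ → E3) : ℝ → E3 :=
  fun x => γ (Function.invFun (fun t => arclength γ 0 t) x)

/-- The Sobolev-Slobodetckij seminorm `[f]_{s,ρ}` of `f : ℝ/(Lℤ) → ℝ³`, with values in
`[0, ∞]`. -/
noncomputable def slobodeckijSeminorm (L s ρ : ℝ) (f : ℝ → E3) : ℝ≥0∞ :=
  (∫⁻ u in Set.Ioc 0 L, ∫⁻ w in Set.Icc (-L / 2) (L / 2),
    ‖f (u + w) - f u‖ₑ ^ ρ / ‖w‖ₑ ^ (1 + ρ * s)) ^ (1 / ρ)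

/-- `g` is a weak (generalized) derivative of `f` on `ℝ/(Lℤ)`: integration by parts against
smooth functions on `ℝ/(Lℤ)`. It is used for `f` and `g` in `L^ρ`, `ρ ≥ 1`, so that both
integrands are integrable. -/
def IsPeriodicWeakDeriv (L : ℝ) (f g : ℝ → E3) : Prop :=
  ∀ φ : ℝ → ℝ, ContDiff ℝ ∞ φ → Function.Periodic φ L →
    ∫ u in (0 : ℝ)..L, deriv φ u • f u = -∫ u in (0 : ℝ)..L, φ u • g u

/-- `f` is of class `W^{k+s,ρ}(ℝ/(Lℤ), ℝ³)`: `D 0 = f, D 1, …, D k` are the weak derivatives of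
`f` up to order `k`, they are `L`-periodic and `ρ`-integrable over a period, and the
Sobolev-Slobodetckij seminorm `[D k]_{s,ρ}` is finite. -/
def MemSobolevSlobodeckij (L : ℝ) (k : ℕ) (s ρ : ℝ) (f : ℝ → E3) : Prop :=
  ∃ D : ℕ → ℝ → E3, D 0 = f ∧
    (∀ j ≤ k, Function.Periodic (D j) L ∧
      MemLp (D j) (ENNReal.ofReal ρ) (volume.restrict (Set.Ioc 0 L))) ∧
    (∀ j < k, IsPeriodicWeakDeriv L (D j) (D (j + 1))) ∧
    slobodeckijSeminorm L s ρ (D k) < ⊤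

/-! ### Integrals over periods -/

/-! Everything rests on one identity. A chord of a curve with derivative `f` is `w` times the mean
`M` of `f (u + s * w)` over `s` in `(0, 1]`. If `‖f‖ = 1` almost everywhere, then `1 - ‖M‖ ^ 2` is
the variance of these values, i.e. half the double average over `s, t` of `‖f (u + s * w) - f (u + t
* w)‖ ^ 2`. Hence the defect between chord and arc is controlled by the differences that enter the
Slobodeckij seminorm.

For (i), the energy is first rewritten in the arclength parameter
(`oharaEnergy_eq_unitSpeedEnergy`). The elementary inequality `q ^ (-α) - 1 ≥ 1 - q ^ 2` for `0 < q
≤ 1` bounds the energy density from below by the variance over `|w| ^ α`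
(`chord_energy_density_ge`). Integrating and substituting `(s - t) * w` for `w` turns this into an
average of truncated seminorms (`lintegral_segment_differences`). Only pairs with `|s - t| ≥ 1 / 2`
are kept, and the truncation radius is then doubled by the triangle inequality, which gives the
constant `32 ≤ 4 ^ 3 * 2 ^ (2 - α)`. Injectivity holds because the density is not integrable near a
double point (`ne_of_unitSpeedEnergy_lt_top`).

For (ii), the weak derivative is shown to be the classical one almost everywhere, by Fourier series,
and finiteness of the seminorm makes dyadic difference quotients converge uniformly, so the
derivative is continuous (`continuous_deriv_of_truncSlobodeckij_lt_top`). Injectivity and regularity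
then give a lower bound `m * |w|` for chords by compactness. With it the variance also bounds the
energy density from above (`chord_energy_density_le`), and averaging over `s, t` returns at most the
seminorm. -/

theorem Function.Periodic.setLIntegral_Ioc_eq {T : ℝ} (hT : 0 < T) {F : ℝ → ℝ≥0∞}
    (hF : Function.Periodic F T) (a b : ℝ) :
    ∫⁻ x in Set.Ioc a (a + T), F x = ∫⁻ x in Set.Ioc b (b + T), F x := by
  have : VAddInvariantMeasure (AddSubgroup.zmultiples T) ℝ volume :=
    ⟨fun c s _ => measure_preimage_add _ _ _⟩
  apply IsAddFundamentalDomain.setLIntegral_eq (G := AddSubgroup.zmultiples T)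
  exacts [isAddFundamentalDomain_Ioc hT a, isAddFundamentalDomain_Ioc hT b,
    hF.map_vadd_zmultiples]

theorem setLIntegral_add_right (F : ℝ → ℝ≥0∞) (s : Set ℝ) (c : ℝ) :
    ∫⁻ x in (fun x => x + c) ⁻¹' s, F (x + c) = ∫⁻ x in s, F x :=
  (measurePreserving_add_right volume c).setLIntegral_comp_preimage_emb
    (measurableEmbedding_addRight c) F s

theorem Function.Periodic.setLIntegral_Ioc_add {T : ℝ} (hT : 0 < T) {F : ℝ → ℝ≥0∞}
    (hF : Function.Periodic F T) (c : ℝ) :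
    ∫⁻ x in Set.Ioc 0 T, F (x + c) = ∫⁻ x in Set.Ioc 0 T, F x := by
  have h := setLIntegral_add_right F (Set.Ioc c (c + T)) c
  simp only [Set.preimage_add_const_Ioc, sub_self, add_sub_cancel_left] at h
  rw [h, hF.setLIntegral_Ioc_eq hT c 0, zero_add]

theorem lintegral_comp_mul_left (H : ℝ → ℝ≥0∞) {r : ℝ} (hr : r ≠ 0) :
    ∫⁻ w, H (r * w) = ENNReal.ofReal |r⁻¹| * ∫⁻ w, H w := by
  have h := (Homeomorph.mulLeft₀ r hr).measurableEmbedding.lintegral_map (μ := volume) H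
  simp only [Homeomorph.coe_mulLeft₀, Real.map_volume_mul_left hr, lintegral_smul_measure] at h
  rw [← h, smul_eq_mul]

theorem setLIntegral_scale (H : ℝ → ℝ≥0∞) {r α : ℝ} (hr : r ≠ 0) (R : ℝ) :
    ∫⁻ w in Set.Icc (-R) R, H (r * w) / ‖w‖ₑ ^ α =
      ENNReal.ofReal (|r| ^ (α - 1)) *
        ∫⁻ w in Set.Icc (-(|r| * R)) (|r| * R), H w / ‖w‖ₑ ^ α := by
  have hr' : 0 < |r| := abs_pos.mpr hr
  rw [← lintegral_indicator measurableSet_Icc, ← lintegral_indicator measurableSet_Icc]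
  have key : ∀ w, (Set.Icc (-R) R).indicator (fun w => H (r * w) / ‖w‖ₑ ^ α) w =
      ENNReal.ofReal (|r| ^ α) *
        (Set.Icc (-(|r| * R)) (|r| * R)).indicator (fun w => H w / ‖w‖ₑ ^ α) (r * w) := by
    intro w
    have hmem : r * w ∈ Set.Icc (-(|r| * R)) (|r| * R) ↔ w ∈ Set.Icc (-R) R := by
      rw [Set.mem_Icc, Set.mem_Icc, ← abs_le, ← abs_le, abs_mul, mul_le_mul_iff_right₀ hr']
    by_cases hw : w ∈ Set.Icc (-R) R
    · rw [Set.indicator_of_mem hw, Set.indicator_of_mem (hmem.mpr hw), enorm_mul]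
      have h1 : ‖r‖ₑ ^ α = ENNReal.ofReal (|r| ^ α) := by
        rw [← ENNReal.ofReal_rpow_of_pos hr', Real.enorm_eq_ofReal_abs]
      have h0 : ‖r‖ₑ ≠ 0 := by simpa using hr
      rw [← h1, ENNReal.mul_rpow_of_ne_top enorm_ne_top enorm_ne_top, ← mul_div_assoc,
        ENNReal.mul_div_mul_left _ _ (by simp [h0]) (by simp [h0])]
    · rw [Set.indicator_of_notMem hw, Set.indicator_of_notMem (mt hmem.mp hw), mul_zero]
  simp_rw [key]
  rw [lintegral_const_mul' _ _ ENNReal.ofReal_ne_top,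
    lintegral_comp_mul_left
      ((Set.Icc (-(|r| * R)) (|r| * R)).indicator (fun w => H w / ‖w‖ₑ ^ α)) hr,
    ← mul_assoc, ← ENNReal.ofReal_mul (by positivity), abs_inv, ← Real.rpow_neg_one |r|,
    ← Real.rpow_add hr', sub_eq_add_neg]

/-! ### Mean square differences and truncated seminorms -/

section Differences

variable {E : Type*} [NormedAddCommGroup E]

/-- The squared `L²`-norm of the difference `f (· + w) - f` over a period. -/
noncomputable def periodDiff (L : ℝ) (f : ℝ → E) (w : ℝ) : ℝ≥0∞ :=
  ∫⁻ u in Set.Ioc 0 L, ‖f (u + w) - f u‖ₑ ^ 2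

/-- The truncated squared Slobodeckij seminorm, with differences of width at most `R`. -/
noncomputable def truncSlobodeckij (L α : ℝ) (f : ℝ → E) (R : ℝ) : ℝ≥0∞ :=
  ∫⁻ w in Set.Icc (-R) R, periodDiff L f w / ‖w‖ₑ ^ α

theorem truncSlobodeckij_mono {L α : ℝ} {f : ℝ → E} {R R' : ℝ} (h : R ≤ R') :
    truncSlobodeckij L α f R ≤ truncSlobodeckij L α f R' :=
  lintegral_mono_set (Set.Icc_subset_Icc (neg_le_neg h) h)

theorem periodDiff_zero (L : ℝ) (f : ℝ → E) : periodDiff L f 0 = 0 := by simp [periodDiff]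

theorem setLIntegral_sub_eq_periodDiff {L : ℝ} (hL : 0 < L) {f : ℝ → E}
    (hf : Function.Periodic f L) (a b : ℝ) :
    ∫⁻ u in Set.Ioc 0 L, ‖f (u + a) - f (u + b)‖ₑ ^ 2 = periodDiff L f (a - b) := by
  have hF : Function.Periodic (fun u => ‖f (u + (a - b)) - f u‖ₑ ^ 2) L := by
    intro u
    simp only [hf u, add_right_comm u L, hf (u + (a - b))]
  rw [periodDiff, ← hF.setLIntegral_Ioc_add hL b]
  simp only [add_assoc, add_sub_cancel]

theorem enorm_add_sq_le (x y : E) : ‖x + y‖ₑ ^ 2 ≤ 2 * (‖x‖ₑ ^ 2 + ‖y‖ₑ ^ 2) := by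
  have h := ENNReal.rpow_add_le_mul_rpow_add_rpow ‖x‖ₑ ‖y‖ₑ (p := 2) one_le_two
  norm_num at h
  exact (pow_le_pow_left' (enorm_add_le x y) 2).trans h

variable [MeasurableSpace E] [BorelSpace E] [SecondCountableTopology E]

theorem measurable_periodDiff {L : ℝ} {f : ℝ → E} (hf : Measurable f) :
    Measurable (periodDiff L f) := by
  unfold periodDiff
  exact Measurable.lintegral_prod_left' (f := fun p : ℝ × ℝ => ‖f (p.1 + p.2) - f p.1‖ₑ ^ 2)
    (by fun_prop)

theorem periodDiff_two_mul_le {L : ℝ} (hL : 0 < L) {f : ℝ → E}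
    (hf : Function.Periodic f L) (hm : Measurable f) (w : ℝ) :
    periodDiff L f (2 * w) ≤ 4 * periodDiff L f w := by
  calc periodDiff L f (2 * w)
      ≤ ∫⁻ u in Set.Ioc 0 L,
          2 * (‖f (u + 2 * w) - f (u + w)‖ₑ ^ 2 + ‖f (u + w) - f u‖ₑ ^ 2) := by
        refine lintegral_mono fun u => ?_
        simpa using enorm_add_sq_le (f (u + 2 * w) - f (u + w)) (f (u + w) - f u)
    _ = 2 * (periodDiff L f (2 * w - w) + periodDiff L f w) := by
        rw [lintegral_const_mul _ (by fun_prop), lintegral_add_left (by fun_prop),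
          setLIntegral_sub_eq_periodDiff hL hf, periodDiff, periodDiff]
    _ = 4 * periodDiff L f w := by rw [two_mul w, add_sub_cancel_right]; ring

/-- Substituting `2 * w` for `w` contributes `2 ^ (1 - α)`, and splitting a difference of width `2 *
w` into two of width `w` contributes `4`. -/
theorem truncSlobodeckij_two_mul_le {L α : ℝ} (hL : 0 < L) {f : ℝ → E}
    (hf : Function.Periodic f L) (hm : Measurable f) (R : ℝ) :
    truncSlobodeckij L α f (2 * R) ≤ ENNReal.ofReal (2 ^ (3 - α)) * truncSlobodeckij L α f R := by
  have h := setLIntegral_scale (periodDiff L f) (r := 2) (α := α) two_ne_zero R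
  rw [abs_two] at h
  have h4 : ∫⁻ w in Set.Icc (-R) R, periodDiff L f (2 * w) / ‖w‖ₑ ^ α ≤
      4 * truncSlobodeckij L α f R := by
    rw [truncSlobodeckij, ← lintegral_const_mul' _ _ (by norm_num)]
    refine lintegral_mono fun w => ?_
    rw [← mul_div_assoc]
    exact ENNReal.div_le_div_right (periodDiff_two_mul_le hL hf hm w) _
  rw [h] at h4
  have h1 : ENNReal.ofReal (2 ^ (1 - α)) * ENNReal.ofReal (2 ^ (α - 1)) = 1 := by
    rw [← ENNReal.ofReal_mul (by positivity), ← Real.rpow_add two_pos]; simp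
  calc truncSlobodeckij L α f (2 * R)
      = ENNReal.ofReal (2 ^ (1 - α)) *
          (ENNReal.ofReal (2 ^ (α - 1)) * truncSlobodeckij L α f (2 * R)) := by
        rw [← mul_assoc, h1, one_mul]
    _ ≤ ENNReal.ofReal (2 ^ (1 - α)) * (4 * truncSlobodeckij L α f R) := mul_le_mul_right h4 _
    _ = ENNReal.ofReal (2 ^ (3 - α)) * truncSlobodeckij L α f R := by
        rw [← mul_assoc]
        congr 1
        rw [show (4 : ℝ≥0∞) = ENNReal.ofReal (2 ^ (2 : ℝ)) by norm_num,
          ← ENNReal.ofReal_mul (by positivity), ← Real.rpow_add two_pos]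
        congr 2; ring

theorem lintegral_div_eq_truncSlobodeckij {L α : ℝ} {f : ℝ → E} (hm : Measurable f) (R : ℝ) :
    ∫⁻ u in Set.Ioc 0 L, ∫⁻ w in Set.Icc (-R) R, ‖f (u + w) - f u‖ₑ ^ 2 / ‖w‖ₑ ^ α =
      truncSlobodeckij L α f R := by
  rw [lintegral_lintegral_swap (by unfold Function.uncurry; fun_prop)]
  refine lintegral_congr fun w => ?_
  simp_rw [div_eq_mul_inv]
  rw [lintegral_mul_const _ (by fun_prop), periodDiff]

/-- The multiple integral obtained by averaging over the differences along a segment. -/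
theorem lintegral_segment_differences {L α : ℝ} (hL : 0 < L) (hα : 1 < α) {f : ℝ → E}
    (hf : Function.Periodic f L) (hm : Measurable f) (R : ℝ) :
    ∫⁻ u in Set.Ioc 0 L, ∫⁻ w in Set.Icc (-R) R,
      (∫⁻ s in Set.Ioc (0 : ℝ) 1, ∫⁻ t in Set.Ioc (0 : ℝ) 1,
        ‖f (u + s * w) - f (u + t * w)‖ₑ ^ 2) / ‖w‖ₑ ^ α =
    ∫⁻ s in Set.Ioc (0 : ℝ) 1, ∫⁻ t in Set.Ioc (0 : ℝ) 1,
      ENNReal.ofReal (|s - t| ^ (α - 1)) * truncSlobodeckij L α f (|s - t| * R) := by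
  have hA := measurable_periodDiff (L := L) hm
  rw [lintegral_lintegral_swap]
  swap
  · refine Measurable.aemeasurable ?_
    unfold Function.uncurry
    refine Measurable.div ?_ (by fun_prop)
    refine Measurable.lintegral_prod_right' (f := fun p : (ℝ × ℝ) × ℝ =>
      ∫⁻ t in Set.Ioc (0 : ℝ) 1, ‖f (p.1.1 + p.2 * p.1.2) - f (p.1.1 + t * p.1.2)‖ₑ ^ 2) ?_
    exact Measurable.lintegral_prod_right' (f := fun p : ((ℝ × ℝ) × ℝ) × ℝ =>
      ‖f (p.1.1.1 + p.1.2 * p.1.1.2) - f (p.1.1.1 + p.2 * p.1.1.2)‖ₑ ^ 2) (by fun_prop)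
  have h1 : ∀ w, (∫⁻ u in Set.Ioc 0 L, (∫⁻ s in Set.Ioc (0 : ℝ) 1, ∫⁻ t in Set.Ioc (0 : ℝ) 1,
        ‖f (u + s * w) - f (u + t * w)‖ₑ ^ 2) / ‖w‖ₑ ^ α) =
      ∫⁻ s in Set.Ioc (0 : ℝ) 1, ∫⁻ t in Set.Ioc (0 : ℝ) 1,
        periodDiff L f ((s - t) * w) / ‖w‖ₑ ^ α := by
    intro w
    simp_rw [div_eq_mul_inv]
    rw [lintegral_mul_const, lintegral_lintegral_swap, ← lintegral_mul_const]
    · refine lintegral_congr fun s => ?_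
      rw [lintegral_lintegral_swap, ← lintegral_mul_const]
      · refine lintegral_congr fun t => ?_
        -- By periodicity in `u`, only the difference `(s - t) * w` of the two shifts matters.
        rw [setLIntegral_sub_eq_periodDiff hL hf, sub_mul]
      · exact Measurable.lintegral_prod_left' (f := fun p : ℝ × ℝ =>
          ‖f (p.1 + s * w) - f (p.1 + p.2 * w)‖ₑ ^ 2) (by fun_prop)
      · unfold Function.uncurry; fun_prop
    · refine Measurable.lintegral_prod_left' (f := fun p : ℝ × ℝ => ∫⁻ t in Set.Ioc (0 : ℝ) 1,
          ‖f (p.1 + p.2 * w) - f (p.1 + t * w)‖ₑ ^ 2) ?_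
      exact Measurable.lintegral_prod_right' (f := fun p : (ℝ × ℝ) × ℝ =>
          ‖f (p.1.1 + p.1.2 * w) - f (p.1.1 + p.2 * w)‖ₑ ^ 2) (by fun_prop)
    · unfold Function.uncurry
      refine Measurable.aemeasurable ?_
      exact Measurable.lintegral_prod_right' (f := fun p : (ℝ × ℝ) × ℝ =>
          ‖f (p.1.1 + p.1.2 * w) - f (p.1.1 + p.2 * w)‖ₑ ^ 2) (by fun_prop)
    · refine Measurable.lintegral_prod_right' (f := fun p : ℝ × ℝ => ∫⁻ t in Set.Ioc (0 : ℝ) 1,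
          ‖f (p.1 + p.2 * w) - f (p.1 + t * w)‖ₑ ^ 2) ?_
      exact Measurable.lintegral_prod_right' (f := fun p : (ℝ × ℝ) × ℝ =>
          ‖f (p.1.1 + p.1.2 * w) - f (p.1.1 + p.2 * w)‖ₑ ^ 2) (by fun_prop)
  simp_rw [h1]
  rw [lintegral_lintegral_swap]
  swap
  · unfold Function.uncurry
    refine Measurable.aemeasurable ?_
    exact Measurable.lintegral_prod_right' (f := fun p : (ℝ × ℝ) × ℝ =>
      periodDiff L f ((p.1.2 - p.2) * p.1.1) / ‖p.1.1‖ₑ ^ α) (by fun_prop)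
  refine lintegral_congr fun s => ?_
  rw [lintegral_lintegral_swap (by unfold Function.uncurry; fun_prop)]
  refine lintegral_congr fun t => ?_
  -- On the diagonal scaling is impossible, but both sides vanish; on the right this uses `0 ^ (α -
  -- 1) = 0`, hence `1 < α`.
  rcases eq_or_ne (s - t) 0 with h | h
  · simp [h, periodDiff_zero, Real.zero_rpow (sub_pos.mpr hα).ne']
  · exact setLIntegral_scale (periodDiff L f) h R

end Differences

/-! ### Variance and chords -/

section Variance

variable {X V : Type*} [MeasurableSpace X] {μ : Measure X} [IsProbabilityMeasure μ]
  [NormedAddCommGroup V] [InnerProductSpace ℝ V] [CompleteSpace V]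

theorem integral_norm_sub_sq {F : X → V} (hF : MemLp F 2 μ) (x : V) :
    ∫ t, ‖x - F t‖ ^ 2 ∂μ = ‖x‖ ^ 2 + ∫ t, ‖F t‖ ^ 2 ∂μ - 2 * inner ℝ x (∫ t, F t ∂μ) := by
  have hi : Integrable F μ := hF.integrable one_le_two
  have h2 : Integrable (fun t => ‖F t‖ ^ 2) μ := hF.integrable_norm_pow two_ne_zero
  have h3 : Integrable (fun t => inner ℝ x (F t)) μ := hi.const_inner x
  have h : ∀ t, ‖x - F t‖ ^ 2 = ‖x‖ ^ 2 + ‖F t‖ ^ 2 - 2 * inner ℝ x (F t) := fun t => by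
    rw [norm_sub_sq_real]; ring
  simp_rw [h]
  have h4 : Integrable (fun t => ‖x‖ ^ 2 + ‖F t‖ ^ 2) μ := (integrable_const _).add h2
  rw [integral_sub h4 (h3.const_mul 2), integral_add (integrable_const _) h2, integral_const_mul,
    integral_inner hi]
  simp

/-- The right side is twice the variance of `F`: expand the square and integrate in each variable.
-/
theorem lintegral_enorm_sub_sq {F : X → V} (hF : MemLp F 2 μ) :
    ∫⁻ s, ∫⁻ t, ‖F s - F t‖ₑ ^ 2 ∂μ ∂μ =
      ENNReal.ofReal (2 * ∫ t, ‖F t‖ ^ 2 ∂μ - 2 * ‖∫ t, F t ∂μ‖ ^ 2) := by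
  have hi : Integrable F μ := hF.integrable one_le_two
  have h2 : Integrable (fun t => ‖F t‖ ^ 2) μ := hF.integrable_norm_pow two_ne_zero
  have h3 : Integrable (fun s => 2 * inner ℝ (F s) (∫ t, F t ∂μ)) μ :=
    (hi.inner_const _).const_mul 2
  have h1 : ∀ s, ∫⁻ t, ‖F s - F t‖ₑ ^ 2 ∂μ =
      ENNReal.ofReal (‖F s‖ ^ 2 + ∫ t, ‖F t‖ ^ 2 ∂μ - 2 * inner ℝ (F s) (∫ t, F t ∂μ)) := by
    intro s
    rw [← integral_norm_sub_sq hF, ofReal_integral_eq_lintegral_ofReal]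
    · refine lintegral_congr fun t => ?_
      rw [ENNReal.ofReal_pow (norm_nonneg _), ofReal_norm]
    · exact ((memLp_const (F s)).sub hF).integrable_norm_pow two_ne_zero
    · exact Filter.Eventually.of_forall fun t => by positivity
  have h4 : Integrable (fun s => ‖F s‖ ^ 2 + ∫ t, ‖F t‖ ^ 2 ∂μ) μ := h2.add (integrable_const _)
  simp_rw [h1]
  rw [← ofReal_integral_eq_lintegral_ofReal]
  · rw [integral_sub h4 h3, integral_add h2 (integrable_const _),
      integral_const_mul]
    simp only [integral_const, probReal_univ, one_smul, real_inner_comm (∫ t, F t ∂μ)]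
    rw [integral_inner hi, real_inner_self_eq_norm_sq]
    ring_nf
  · exact h4.sub h3
  · refine Filter.Eventually.of_forall fun s => ?_
    beta_reduce
    rw [← integral_norm_sub_sq hF]
    positivity

end Variance

instance isProbabilityMeasure_restrict_Ioc_zero_one :
    IsProbabilityMeasure (volume.restrict (Set.Ioc (0 : ℝ) 1)) := ⟨by simp⟩

theorem quasiMeasurePreserving_affine (u : ℝ) {w : ℝ} (hw : w ≠ 0) :
    Measure.QuasiMeasurePreserving (fun s : ℝ => u + s * w) volume volume := by
  refine (measurePreserving_add_left volume u).quasiMeasurePreserving.comp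
    (g := fun x => u + x) (f := fun s => s * w) ⟨by fun_prop, ?_⟩
  rw [Real.map_volume_mul_right hw]
  exact Measure.smul_absolutelyContinuous

theorem Continuous.memLp_restrict_Ioc {V : Type*} [NormedAddCommGroup V] {f : ℝ → V}
    (hf : Continuous f) (p : ℝ≥0∞) (a b : ℝ) : MemLp f p (volume.restrict (Set.Ioc a b)) := by
  obtain ⟨C, hC⟩ := (isCompact_Icc (a := a) (b := b)).exists_bound_of_continuousOn hf.continuousOn
  exact MemLp.of_bound hf.aestronglyMeasurable C
    (ae_restrict_of_forall_mem measurableSet_Ioc fun x hx => hC x (Set.Ioc_subset_Icc_self hx))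

theorem chord_eq_smul_integral {V : Type*} [NormedAddCommGroup V] [NormedSpace ℝ V]
    {f Γ : ℝ → V} (h : ∀ a b, ∫ x in a..b, f x = Γ b - Γ a) (u w : ℝ) :
    Γ (u + w) - Γ u = w • ∫ s in Set.Ioc (0 : ℝ) 1, f (u + s * w) := by
  rw [← intervalIntegral.integral_of_le zero_le_one]
  simp_rw [mul_comm _ w]
  rw [intervalIntegral.smul_integral_comp_add_mul, h]
  simp

/-- With `q = c / d ≤ 1` this is `q ^ (-α) - 1 ≥ q ^ (-2) - 1 ≥ 1 - q ^ 2`; the last inequality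
amounts to `(q ^ 2 - 1) ^ 2 ≥ 0`. -/
theorem rpow_neg_sub_rpow_neg_ge {α c d : ℝ} (hα : 2 ≤ α) (hc : 0 < c) (hcd : c ≤ d) :
    (1 - c ^ 2 / d ^ 2) * (d ^ α)⁻¹ ≤ (c ^ α)⁻¹ - (d ^ α)⁻¹ := by
  have hd : 0 < d := hc.trans_le hcd
  set q := c / d with hq
  have hq0 : 0 < q := by positivity
  have hq1 : q ≤ 1 := (div_le_one hd).mpr hcd
  have hqα : q ^ α ≤ q ^ 2 := by
    rw [← Real.rpow_two]; exact Real.rpow_le_rpow_of_exponent_ge hq0 hq1 hα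
  have hc' : c = q * d := by rw [hq]; field_simp
  have h1 : c ^ α = q ^ α * d ^ α := by rw [hc', Real.mul_rpow hq0.le hd.le]
  have h2 : 2 - q ^ 2 ≤ (q ^ α)⁻¹ := by
    have h3 : (q ^ 2)⁻¹ ≤ (q ^ α)⁻¹ := by gcongr
    refine le_trans ?_ h3
    rw [← one_div, le_div_iff₀ (by positivity)]
    nlinarith [sq_nonneg (q ^ 2 - 1)]
  have hdα : 0 ≤ (d ^ α)⁻¹ := by positivity
  rw [h1, mul_inv, ← div_pow, ← hq]
  nlinarith

/-- With `q = c / a ≤ 1` and `α ≤ 4`, `1 - q ^ α ≤ 1 - q ^ 4 ≤ 2 * (1 - q ^ 2)`. The bounds `c, a ≥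
m * d` convert the powers of `c` and `a` in the denominators into powers of `d`, at the cost of `m ^
(-α)` and `m ^ (-2)`. -/
theorem rpow_neg_sub_rpow_neg_le {α c a d m : ℝ} (hα : 0 ≤ α) (hα' : α ≤ 4) (hm : 0 < m)
    (hd : 0 < d) (hmc : m * d ≤ c) (hca : c ≤ a) :
    (c ^ α)⁻¹ - (a ^ α)⁻¹ ≤ 2 * (m ^ (α + 2))⁻¹ * ((a ^ 2 - c ^ 2) / d ^ 2) * (d ^ α)⁻¹ := by
  have hc : 0 < c := (by positivity : 0 < m * d).trans_le hmc
  have ha : 0 < a := hc.trans_le hca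
  set q := c / a with hq
  have hq0 : 0 < q := by positivity
  have hq1 : q ≤ 1 := (div_le_one ha).mpr hca
  have hq4 : q ^ 4 ≤ q ^ α := by
    have := Real.rpow_le_rpow_of_exponent_ge hq0 hq1 hα'
    exact_mod_cast this
  have hc' : c = q * a := by rw [hq]; field_simp
  have h1 : (c ^ α)⁻¹ - (a ^ α)⁻¹ = (c ^ α)⁻¹ * (1 - q ^ α) := by
    rw [hq, Real.div_rpow hc.le ha.le]; field_simp
  have h2 : 1 - q ^ α ≤ 2 * (1 - q ^ 2) := by nlinarith [sq_nonneg (q ^ 2 - 1)]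
  have h3 : 1 - q ^ 2 = (a ^ 2 - c ^ 2) / a ^ 2 := by rw [hq]; field_simp
  have h4 : 0 ≤ a ^ 2 - c ^ 2 := by nlinarith
  have h5 : (c ^ α)⁻¹ ≤ (m ^ α)⁻¹ * (d ^ α)⁻¹ := by
    rw [← mul_inv, ← Real.mul_rpow hm.le hd.le]
    gcongr
  have h6 : (a ^ 2 - c ^ 2) / a ^ 2 ≤ (m ^ 2)⁻¹ * ((a ^ 2 - c ^ 2) / d ^ 2) := by
    rw [← div_eq_inv_mul, div_div, ← mul_pow]
    have : d * m ≤ a := by linarith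
    gcongr
  have h7 : (m ^ (α + 2))⁻¹ = (m ^ α)⁻¹ * (m ^ 2)⁻¹ := by
    rw [Real.rpow_add hm, Real.rpow_two, mul_inv]
  calc (c ^ α)⁻¹ - (a ^ α)⁻¹ ≤ (c ^ α)⁻¹ * (2 * ((a ^ 2 - c ^ 2) / a ^ 2)) := by
        rw [h1, ← h3]; gcongr
    _ ≤ ((m ^ α)⁻¹ * (d ^ α)⁻¹) * (2 * ((m ^ 2)⁻¹ * ((a ^ 2 - c ^ 2) / d ^ 2))) := by
        gcongr
    _ = _ := by rw [h7]; ring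

theorem one_div_ofReal_rpow {c : ℝ} (hc : 0 < c) (α : ℝ) :
    1 / ENNReal.ofReal c ^ α = ENNReal.ofReal (c ^ α)⁻¹ := by
  rw [ENNReal.ofReal_rpow_of_pos hc, one_div, ENNReal.ofReal_inv_of_pos (by positivity)]

section Chord

variable {V : Type*} [NormedAddCommGroup V] [InnerProductSpace ℝ V] [CompleteSpace V]

theorem chord_energy_density_ge {α : ℝ} (hα : 2 ≤ α) {f Γ : ℝ → V}
    (hm : AEStronglyMeasurable f)
    (h : ∀ a b, ∫ x in a..b, f x = Γ b - Γ a) (hf : ∀ᵐ x, ‖f x‖ = 1) (u : ℝ) {w : ℝ}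
    (hw : w ≠ 0) :
    (1 / 2) * ((∫⁻ s in Set.Ioc (0 : ℝ) 1, ∫⁻ t in Set.Ioc (0 : ℝ) 1,
        ‖f (u + s * w) - f (u + t * w)‖ₑ ^ 2) / ‖w‖ₑ ^ α) ≤
      1 / ‖Γ (u + w) - Γ u‖ₑ ^ α - 1 / ‖w‖ₑ ^ α := by
  have hd : 0 < |w| := abs_pos.mpr hw
  have h1 := ae_restrict_of_ae (s := Set.Ioc (0 : ℝ) 1) 
    ((quasiMeasurePreserving_affine u hw).ae hf)
  have hmeas : AEStronglyMeasurable (fun s : ℝ => f (u + s * w))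
      (volume.restrict (Set.Ioc 0 1)) := by
    refine AEStronglyMeasurable.restrict ?_
    exact hm.comp_quasiMeasurePreserving (quasiMeasurePreserving_affine u hw)
  have hL : MemLp (fun s : ℝ => f (u + s * w)) 2 (volume.restrict (Set.Ioc 0 1)) :=
    MemLp.of_bound hmeas 1 (h1.mono fun s hs => hs.le)
  have h2 : ∫ s in Set.Ioc (0 : ℝ) 1, ‖f (u + s * w)‖ ^ 2 = 1 := by
    rw [integral_congr_ae (g := fun _ => 1) (h1.mono fun s hs => by simp [hs])]
    simp
  rw [lintegral_enorm_sub_sq hL, h2]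
  set M := ∫ s in Set.Ioc (0 : ℝ) 1, f (u + s * w) with hM
  have hchord : ‖Γ (u + w) - Γ u‖ = |w| * ‖M‖ := by
    rw [chord_eq_smul_integral h, norm_smul, Real.norm_eq_abs]
  have hM1 : ‖M‖ ≤ 1 := by
    have := norm_integral_le_of_norm_le_const (h1.mono fun s hs => hs.le)
    simpa using this
  rw [← ofReal_norm, ← ofReal_norm, hchord, Real.norm_eq_abs]
  -- If the chord vanishes, the right side is `⊤` minus a finite number, so nothing is to be shown.
  rcases (norm_nonneg M).eq_or_lt' with h0 | h0
  · rw [h0, mul_zero, ENNReal.ofReal_zero, ENNReal.zero_rpow_of_pos (by linarith),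
      one_div_ofReal_rpow hd]
    simp
  · have hc : 0 < |w| * ‖M‖ := by positivity
    rw [one_div_ofReal_rpow hd, one_div_ofReal_rpow hc, ← ENNReal.ofReal_sub _ (by positivity),
      div_eq_mul_one_div _ (ENNReal.ofReal |w| ^ α), one_div_ofReal_rpow hd,
      ← ENNReal.ofReal_mul' (by positivity),
      show (1 / 2 : ℝ≥0∞) = ENNReal.ofReal (1 / 2) by
        rw [ENNReal.ofReal_div_of_pos two_pos]; simp,
      ← ENNReal.ofReal_mul (by norm_num)]
    refine ENNReal.ofReal_le_ofReal ?_
    have := rpow_neg_sub_rpow_neg_ge hα hc (mul_le_of_le_one_right hd.le hM1)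
    rw [mul_pow, mul_div_cancel_left₀ _ (by positivity)] at this
    refine le_trans (le_of_eq ?_) this
    ring

/-- The speed need not be constant here. The arc is `|w|` times the mean `N` of `‖f‖`, and `N ^ 2`
is at most the mean `Q` of `‖f‖ ^ 2`, so `N ^ 2 - ‖M‖ ^ 2` is still bounded by the variance `Q - ‖M‖
^ 2`. Allowing any `d` below the arc length covers the intrinsic distance without deciding which arc
is shorter. -/
theorem chord_energy_density_le {α m : ℝ} (hα : 0 ≤ α) (hα' : α ≤ 4) (hm : 0 < m) {f Γ : ℝ → V}
    (hf : Continuous f) (h : ∀ a b, ∫ x in a..b, f x = Γ b - Γ a) (u : ℝ) {w : ℝ}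
    (hw : w ≠ 0) (hmw : m * |w| ≤ ‖Γ (u + w) - Γ u‖) {d : ℝ}
    (hd : d ≤ |∫ x in u..(u + w), ‖f x‖|) :
    1 / ‖Γ (u + w) - Γ u‖ₑ ^ α - 1 / ENNReal.ofReal d ^ α ≤
      ENNReal.ofReal ((m ^ (α + 2))⁻¹) *
        ((∫⁻ s in Set.Ioc (0 : ℝ) 1, ∫⁻ t in Set.Ioc (0 : ℝ) 1,
          ‖f (u + s * w) - f (u + t * w)‖ₑ ^ 2) / ‖w‖ₑ ^ α) := by
  have hw0 : 0 < |w| := abs_pos.mpr hw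
  have hcont : Continuous fun s : ℝ => f (u + s * w) := by fun_prop
  have hL : MemLp (fun s : ℝ => f (u + s * w)) 2 (volume.restrict (Set.Ioc 0 1)) :=
    hcont.memLp_restrict_Ioc 2 0 1
  rw [lintegral_enorm_sub_sq hL]
  set M := ∫ s in Set.Ioc (0 : ℝ) 1, f (u + s * w) with hM
  set N := ∫ s in Set.Ioc (0 : ℝ) 1, ‖f (u + s * w)‖ with hN
  set Q := ∫ s in Set.Ioc (0 : ℝ) 1, ‖f (u + s * w)‖ ^ 2 with hQ
  have hchord : ‖Γ (u + w) - Γ u‖ = |w| * ‖M‖ := by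
    rw [chord_eq_smul_integral h, norm_smul, Real.norm_eq_abs]
  have hN0 : 0 ≤ N := integral_nonneg fun s => norm_nonneg _
  have harc : |∫ x in u..(u + w), ‖f x‖| = |w| * N := by
    have hfn : Continuous fun x => ‖f x‖ := hf.norm
    have := chord_eq_smul_integral (f := fun x => ‖f x‖) (Γ := fun b => ∫ x in (0:ℝ)..b, ‖f x‖)
      (fun a b => (intervalIntegral.integral_interval_sub_left
        (hfn.intervalIntegrable _ _) (hfn.intervalIntegrable _ _)).symm) u w
    rw [intervalIntegral.integral_interval_sub_left
        (hfn.intervalIntegrable _ _) (hfn.intervalIntegrable _ _)] at this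
    rw [this, smul_eq_mul, abs_mul, abs_of_nonneg hN0]
  have hMN : ‖M‖ ≤ N := norm_integral_le_integral_norm _
  -- Nonnegativity of the variance of the speed.
  have hNQ : N ^ 2 ≤ Q := by
    have h0 := integral_norm_sub_sq (hL.norm) N
    have h1 : 0 ≤ ∫ s in Set.Ioc (0 : ℝ) 1, ‖N - ‖f (u + s * w)‖‖ ^ 2 :=
      integral_nonneg fun s => by positivity
    simp only [norm_norm] at h0
    rw [h0, ← hN, real_inner_self_eq_norm_sq] at h1
    rw [Real.norm_of_nonneg hN0] at h1
    linarith
  have hc : 0 < |w| * ‖M‖ := by rw [← hchord]; exact (by positivity : 0 < m * |w|).trans_le hmw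
  have ha : 0 < |w| * N := hc.trans_le (by gcongr)
  calc 1 / ‖Γ (u + w) - Γ u‖ₑ ^ α - 1 / ENNReal.ofReal d ^ α
      ≤ 1 / ENNReal.ofReal (|w| * ‖M‖) ^ α - 1 / ENNReal.ofReal (|w| * N) ^ α := by
        rw [← ofReal_norm, hchord]
        refine tsub_le_tsub_left ?_ _
        rw [← harc]
        exact ENNReal.div_le_div_left
          (ENNReal.rpow_le_rpow (ENNReal.ofReal_le_ofReal hd) hα) _
    _ = ENNReal.ofReal (((|w| * ‖M‖) ^ α)⁻¹ - ((|w| * N) ^ α)⁻¹) := by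
        rw [one_div_ofReal_rpow hc, one_div_ofReal_rpow ha, ENNReal.ofReal_sub _ (by positivity)]
    _ ≤ ENNReal.ofReal ((m ^ (α + 2))⁻¹ * ((2 * Q - 2 * ‖M‖ ^ 2) * (|w| ^ α)⁻¹)) := by
        refine ENNReal.ofReal_le_ofReal ?_
        refine (rpow_neg_sub_rpow_neg_le hα hα' hm hw0 (hchord ▸ hmw) (by gcongr)).trans ?_
        have h1 : ((|w| * N) ^ 2 - (|w| * ‖M‖) ^ 2) / |w| ^ 2 = N ^ 2 - ‖M‖ ^ 2 := by
          field_simp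
        have h2 : 0 ≤ (m ^ (α + 2))⁻¹ * (|w| ^ α)⁻¹ := by positivity
        rw [h1]
        nlinarith [mul_le_mul_of_nonneg_left hNQ h2]
    _ = _ := by
        rw [ENNReal.ofReal_mul (by positivity), ENNReal.ofReal_mul' (by positivity),
          ← one_div_ofReal_rpow hw0, ← Real.enorm_eq_ofReal_abs, ← div_eq_mul_one_div]

end Chord

/-! ### Estimates for curves parametrized by arclength -/

theorem slobodeckijSeminorm_sq {L α : ℝ} {f : ℝ → E3} (hm : Measurable f) :
    slobodeckijSeminorm L ((α - 1) / 2) 2 f ^ 2 = truncSlobodeckij L α f (L / 2) := by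
  rw [← lintegral_div_eq_truncSlobodeckij hm, slobodeckijSeminorm, ← ENNReal.rpow_natCast,
    ← ENNReal.rpow_mul]
  norm_num
  simp only [neg_div]
  ring_nf

/-- The energy of a curve parametrized by arclength. -/
noncomputable def unitSpeedEnergy {V : Type*} [NormedAddCommGroup V] (L α : ℝ) (Γ : ℝ → V) :
    ℝ≥0∞ :=
  ∫⁻ x in Set.Ioc 0 L, ∫⁻ w in Set.Icc (-(L / 2)) (L / 2),
    (1 / ‖Γ (x + w) - Γ x‖ₑ ^ α - 1 / ‖w‖ₑ ^ α)

/-! ### Averages over pairs of parameters on a segment -/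

theorem volume_far_parameters_ge {s : ℝ} (hs : s ∈ Set.Ioc (0 : ℝ) 1) :
    ENNReal.ofReal |s - 1 / 2| ≤ volume (Set.Ioc (0 : ℝ) 1 ∩ {t | 1 / 2 ≤ |s - t|}) := by
  rcases le_total (1 / 2) s with h | h
  · have e : ENNReal.ofReal |s - 1 / 2| = volume (Set.Ioc 0 (s - 1 / 2)) := by
      rw [Real.volume_Ioc, sub_zero, abs_of_nonneg (by linarith)]
    rw [e]
    refine measure_mono fun t ht => ⟨⟨ht.1, by linarith [ht.2, hs.2]⟩, ?_⟩
    rw [Set.mem_ofPred_eq, abs_of_nonneg (by linarith [ht.2])]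
    linarith [ht.2]
  · have e : ENNReal.ofReal |s - 1 / 2| = volume (Set.Icc (s + 1 / 2) 1) := by
      rw [Real.volume_Icc, abs_of_nonpos (by linarith)]; congr 1; ring
    rw [e]
    refine measure_mono fun t ht => ⟨⟨by linarith [ht.1, hs.1], ht.2⟩, ?_⟩
    rw [Set.mem_ofPred_eq, abs_of_nonpos (by linarith [ht.1])]
    linarith [ht.1]

theorem lintegral_abs_sub_half :
    ∫⁻ s in Set.Ioc (0 : ℝ) 1, ENNReal.ofReal |s - 1 / 2| = ENNReal.ofReal (1 / 4) := by
  have hc : Continuous fun s : ℝ => |s - 1 / 2| := by fun_prop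
  rw [← ofReal_integral_eq_lintegral_ofReal hc.integrableOn_Ioc
    (Filter.Eventually.of_forall fun s => abs_nonneg _),
    ← intervalIntegral.integral_of_le zero_le_one,
    ← intervalIntegral.integral_add_adjacent_intervals (b := 1 / 2)
      (hc.intervalIntegrable _ _) (hc.intervalIntegrable _ _)]
  congr 1
  have h1 : ∫ s in (0 : ℝ)..(1 / 2), |s - 1 / 2| = ∫ s in (0 : ℝ)..(1 / 2), (1 / 2 - s) := by
    refine intervalIntegral.integral_congr fun s hs => ?_
    rw [Set.uIcc_of_le (by norm_num)] at hs
    rw [abs_of_nonpos (by linarith [hs.2])]; ring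
  have h2 : ∫ s in (1 / 2 : ℝ)..1, |s - 1 / 2| = ∫ s in (1 / 2 : ℝ)..1, (s - 1 / 2) := by
    refine intervalIntegral.integral_congr fun s hs => ?_
    rw [Set.uIcc_of_le (by norm_num)] at hs
    rw [abs_of_nonneg (by linarith [hs.1])]
  rw [h1, h2, intervalIntegral.integral_sub (by simp) (by simp),
    intervalIntegral.integral_sub (by simp) (by simp)]
  simp only [integral_id, intervalIntegral.integral_const]
  norm_num

section Averages

variable {V : Type*} [NormedAddCommGroup V]

/-- Pairs with `|s - t| ≥ 1 / 2` fill area `1 / 4` of the unit square; on them the weight is at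
least `2 ^ (1 - α)` and the truncation radius at least `R / 2`. -/
theorem segment_average_ge {L α : ℝ} (hα : 1 ≤ α) (f : ℝ → V) {R : ℝ} (hR : 0 ≤ R) :
    ENNReal.ofReal (1 / 4) * (ENNReal.ofReal (2 ^ (1 - α)) * truncSlobodeckij L α f (R / 2)) ≤
      ∫⁻ s in Set.Ioc (0 : ℝ) 1, ∫⁻ t in Set.Ioc (0 : ℝ) 1,
        ENNReal.ofReal (|s - t| ^ (α - 1)) * truncSlobodeckij L α f (|s - t| * R) := by
  set c := ENNReal.ofReal (2 ^ (1 - α)) * truncSlobodeckij L α f (R / 2) with hc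
  rw [← lintegral_abs_sub_half, ← lintegral_mul_const _ (by fun_prop)]
  refine setLIntegral_mono' measurableSet_Ioc fun s hs => ?_
  have hms : MeasurableSet {t : ℝ | 1 / 2 ≤ |s - t|} :=
    measurableSet_le measurable_const (by fun_prop)
  calc ENNReal.ofReal |s - 1 / 2| * c
      ≤ volume (Set.Ioc (0 : ℝ) 1 ∩ {t | 1 / 2 ≤ |s - t|}) * c := by
        gcongr; exact volume_far_parameters_ge hs
    _ = ∫⁻ t in Set.Ioc (0 : ℝ) 1 ∩ {t | 1 / 2 ≤ |s - t|}, c := by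
        rw [setLIntegral_const, mul_comm]
    _ ≤ ∫⁻ t in Set.Ioc (0 : ℝ) 1 ∩ {t | 1 / 2 ≤ |s - t|},
          ENNReal.ofReal (|s - t| ^ (α - 1)) * truncSlobodeckij L α f (|s - t| * R) := by
        refine setLIntegral_mono' (measurableSet_Ioc.inter hms) fun t ht => ?_
        have h : 1 / 2 ≤ |s - t| := ht.2
        rw [hc]
        refine mul_le_mul' (ENNReal.ofReal_le_ofReal ?_) (truncSlobodeckij_mono ?_)
        · calc (2 : ℝ) ^ (1 - α) = (1 / 2) ^ (α - 1) := by
                rw [one_div, Real.inv_rpow two_pos.le, ← Real.rpow_neg two_pos.le, neg_sub]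
            _ ≤ |s - t| ^ (α - 1) := by gcongr
        · nlinarith
    _ ≤ _ := lintegral_mono_set Set.inter_subset_left

theorem segment_average_le {L α : ℝ} (hα : 1 ≤ α) (f : ℝ → V) {R : ℝ} (hR : 0 ≤ R) :
    ∫⁻ s in Set.Ioc (0 : ℝ) 1, ∫⁻ t in Set.Ioc (0 : ℝ) 1,
        ENNReal.ofReal (|s - t| ^ (α - 1)) * truncSlobodeckij L α f (|s - t| * R) ≤
      truncSlobodeckij L α f R := by
  calc _ ≤ ∫⁻ s in Set.Ioc (0 : ℝ) 1, ∫⁻ t in Set.Ioc (0 : ℝ) 1, truncSlobodeckij L α f R := by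
        refine setLIntegral_mono' measurableSet_Ioc fun s hs =>
          setLIntegral_mono' measurableSet_Ioc fun t ht => ?_
        have h : |s - t| ≤ 1 := by
          rw [abs_le]; constructor <;> linarith [hs.1, hs.2, ht.1, ht.2]
        rw [← one_mul (truncSlobodeckij L α f R)]
        refine mul_le_mul' ?_ (truncSlobodeckij_mono (by nlinarith))
        rw [← ENNReal.ofReal_one]
        exact ENNReal.ofReal_le_ofReal (Real.rpow_le_one (abs_nonneg _) h (by linarith))
    _ = _ := by simp

variable [InnerProductSpace ℝ V] [CompleteSpace V] [MeasurableSpace V] [BorelSpace V]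
  [SecondCountableTopology V]

/-- The constant is `2 ^ (3 - α)` from doubling the radius `L / 4`, times `2` from the variance,
times `4 * 2 ^ (α - 1)` from the average; the powers depending on `α` cancel to leave `32`. -/
theorem truncSlobodeckij_le_unitSpeedEnergy {L α : ℝ} (hL : 0 < L) (hα : 2 ≤ α) {f Γ : ℝ → V}
    (hf : Function.Periodic f L) (hm : Measurable f) (hf1 : ∀ᵐ x, ‖f x‖ = 1)
    (h : ∀ a b, ∫ x in a..b, f x = Γ b - Γ a) :
    truncSlobodeckij L α f (L / 2) ≤ ENNReal.ofReal 32 * unitSpeedEnergy L α Γ := by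
  have h1 : ENNReal.ofReal (1 / 2) * (ENNReal.ofReal (1 / 4) *
      (ENNReal.ofReal (2 ^ (1 - α)) * truncSlobodeckij L α f (L / 2 / 2))) ≤
      unitSpeedEnergy L α Γ := by
    calc _ ≤ ENNReal.ofReal (1 / 2) * ∫⁻ u in Set.Ioc 0 L, ∫⁻ w in Set.Icc (-(L / 2)) (L / 2),
        (∫⁻ s in Set.Ioc (0 : ℝ) 1, ∫⁻ t in Set.Ioc (0 : ℝ) 1,
        ‖f (u + s * w) - f (u + t * w)‖ₑ ^ 2) / ‖w‖ₑ ^ α := by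
          rw [lintegral_segment_differences hL (by linarith) hf hm]
          gcongr
          exact segment_average_ge (by linarith) f (by linarith)
      _ ≤ _ := by
          rw [← lintegral_const_mul' _ _ ENNReal.ofReal_ne_top]
          refine lintegral_mono fun u => ?_
          rw [← lintegral_const_mul' _ _ ENNReal.ofReal_ne_top]
          refine lintegral_mono_ae ?_
          have h0 : ∀ᵐ w : ℝ ∂volume.restrict (Set.Icc (-(L / 2)) (L / 2)), w ≠ 0 :=
            ae_restrict_of_ae (by simp [ae_iff])
          filter_upwards [h0] with w hw
          have := chord_energy_density_ge hα hm.aestronglyMeasurable h hf1 u hw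
          rwa [show (1 / 2 : ℝ≥0∞) = ENNReal.ofReal (1 / 2) by
            rw [ENNReal.ofReal_div_of_pos two_pos]; simp] at this
  calc truncSlobodeckij L α f (L / 2)
      ≤ ENNReal.ofReal (2 ^ (3 - α)) * truncSlobodeckij L α f (L / 2 / 2) := by
        have := truncSlobodeckij_two_mul_le (α := α) hL hf hm (L / 2 / 2)
        rwa [mul_div_cancel₀ _ two_ne_zero] at this
    _ = ENNReal.ofReal 32 * (ENNReal.ofReal (1 / 2) * (ENNReal.ofReal (1 / 4) *
      (ENNReal.ofReal (2 ^ (1 - α)) * truncSlobodeckij L α f (L / 2 / 2)))) := by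
        simp only [← mul_assoc]
        rw [← ENNReal.ofReal_mul (by norm_num), ← ENNReal.ofReal_mul (by norm_num),
          ← ENNReal.ofReal_mul (by norm_num)]
        congr 2
        rw [show 3 - α = 2 + (1 - α) by ring, Real.rpow_add two_pos]
        norm_num
    _ ≤ _ := mul_le_mul_right h1 _

end Averages

/-! ### Double points have infinite energy -/

theorem lintegral_ofReal_const_mul_inv {c ε : ℝ} (hc : 0 < c) (hε : 0 < ε) :
    ∫⁻ a in Set.Ioo 0 ε, ENNReal.ofReal (c * a⁻¹) = ⊤ := by
  by_contra hne
  have h : IntegrableOn (fun a : ℝ => c * a⁻¹) (Set.Ioo 0 ε) := by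
    refine ⟨by fun_prop, ?_⟩
    rw [hasFiniteIntegral_iff_ofReal]
    · exact lt_top_iff_ne_top.mpr hne
    · exact ae_restrict_of_forall_mem measurableSet_Ioo fun a ha =>
        mul_nonneg hc.le (inv_nonneg.mpr ha.1.le)
  have h2 : IntegrableOn (fun a : ℝ => a ^ (-1 : ℝ)) (Set.Ioo 0 ε) := by
    refine (h.const_mul c⁻¹).congr (Filter.Eventually.of_forall fun a => ?_)
    simp only [Real.rpow_neg_one]
    field_simp
  exact lt_irrefl _ ((intervalIntegral.integrableOn_Ioo_rpow_iff hε).mp h2)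

/-- At a double point, the chord from `x₀ + a` with `w` in `(w₀ - a, w₀)` has length at most `2 *
a`, while `|w|` stays above `4 * a`. The density is then at least a multiple of `a ^ (-α)` on a
`w`-interval of length `a`, and `a ^ (1 - α) ≥ a⁻¹` is not integrable at `0`. -/
theorem ne_of_unitSpeedEnergy_lt_top {V : Type*} [NormedAddCommGroup V] {L α : ℝ} (hL : 0 < L)
    (hα : 2 ≤ α) {Γ : ℝ → V} (hΓ : Function.Periodic Γ L) (hlip : LipschitzWith 1 Γ)
    (hE : unitSpeedEnergy L α Γ < ⊤) (x₀ : ℝ) {w₀ : ℝ} (hw : 0 < w₀) (hw' : w₀ ≤ L / 2) :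
    Γ (x₀ + w₀) ≠ Γ x₀ := by
  intro heq
  refine hE.ne (top_le_iff.mp ?_)
  have hdist : ∀ a b, ‖Γ a - Γ b‖ ≤ |a - b| := fun a b => by
    simpa [dist_eq_norm] using hlip.dist_le_mul a b
  -- The bound by `1` gives `a ^ α ≤ a ^ 2`; the bound by `w₀ / 8` gives `4 * a ≤ w₀ - a`.
  set ε := min 1 (w₀ / 8) with hε
  have hε0 : 0 < ε := by positivity
  have hε1 : ε ≤ 1 := min_le_left _ _
  have hε2 : ε ≤ w₀ / 8 := min_le_right _ _
  -- Chosen so that `c * a ^ (-α) ≤ (2 * a) ^ (-α) - (4 * a) ^ (-α)`, using `2 ^ α ≥ 2`.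
  set c : ℝ := 1 / 2 * (2 ^ α)⁻¹ with hc
  have hper : Function.Periodic (fun x => ∫⁻ w in Set.Icc (-(L / 2)) (L / 2),
      (1 / ‖Γ (x + w) - Γ x‖ₑ ^ α - 1 / ‖w‖ₑ ^ α)) L := by
    intro x
    simp only [add_right_comm x L, hΓ x, hΓ (x + _)]
  rw [unitSpeedEnergy, ← hper.setLIntegral_Ioc_add hL x₀,
    ← lintegral_ofReal_const_mul_inv (by positivity : 0 < c) hε0]
  refine le_trans (setLIntegral_mono' measurableSet_Ioo fun a ha => ?_)
    (lintegral_mono_set (Set.Ioo_subset_Ioc_self.trans (Set.Ioc_subset_Ioc_right (by linarith))))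
  obtain ⟨ha0, ha1⟩ := ha
  calc ENNReal.ofReal (c * a⁻¹) ≤ ENNReal.ofReal (c * (a ^ α)⁻¹ * a) := by
        refine ENNReal.ofReal_le_ofReal ?_
        rw [mul_assoc c]
        refine mul_le_mul_of_nonneg_left (a := c) ?_ (by positivity)
        have h2 : a ^ α ≤ a ^ 2 := by
          rw [← Real.rpow_two]
          exact Real.rpow_le_rpow_of_exponent_ge ha0 (by linarith) hα
        calc a⁻¹ = (a ^ 2)⁻¹ * a := by field_simp
          _ ≤ (a ^ α)⁻¹ * a := by gcongr
    _ = ∫⁻ w in Set.Ioo (w₀ - a) w₀, ENNReal.ofReal (c * (a ^ α)⁻¹) := by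
        rw [setLIntegral_const, Real.volume_Ioo, ← ENNReal.ofReal_mul (by positivity)]
        congr 2; ring
    _ ≤ ∫⁻ w in Set.Ioo (w₀ - a) w₀,
          (1 / ‖Γ (a + x₀ + w) - Γ (a + x₀)‖ₑ ^ α - 1 / ‖w‖ₑ ^ α) := by
        refine setLIntegral_mono' measurableSet_Ioo fun w hw1 => ?_
        obtain ⟨hw1, hw2⟩ := hw1
        have h1 : ‖Γ (a + x₀ + w) - Γ (a + x₀)‖ ≤ 2 * a := by
          have e1 := hdist (a + x₀ + w) (x₀ + w₀)
          have e2 := hdist x₀ (a + x₀)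
          rw [show a + x₀ + w - (x₀ + w₀) = a + w - w₀ by ring, abs_of_nonneg (by linarith)] at e1
          rw [show x₀ - (a + x₀) = -a by ring, abs_neg, abs_of_pos ha0] at e2
          have := norm_add_le (Γ (a + x₀ + w) - Γ (x₀ + w₀)) (Γ x₀ - Γ (a + x₀))
          rw [heq] at this e1
          rw [sub_add_sub_cancel] at this
          linarith
        have h2 : 1 / ENNReal.ofReal (2 * a) ^ α ≤
            1 / ‖Γ (a + x₀ + w) - Γ (a + x₀)‖ₑ ^ α := by
          rw [← ofReal_norm]
          exact ENNReal.div_le_div_left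
            (ENNReal.rpow_le_rpow (ENNReal.ofReal_le_ofReal h1) (by linarith)) _
        have h3 : 1 / ‖w‖ₑ ^ α ≤ 1 / ENNReal.ofReal (4 * a) ^ α := by
          rw [Real.enorm_eq_ofReal_abs]
          refine ENNReal.div_le_div_left
            (ENNReal.rpow_le_rpow (ENNReal.ofReal_le_ofReal ?_) (by linarith)) _
          exact le_trans (by linarith) (le_abs_self w)
        refine le_trans ?_ (tsub_le_tsub h2 h3)
        rw [one_div_ofReal_rpow (by positivity), one_div_ofReal_rpow (by positivity),
          ← ENNReal.ofReal_sub _ (by positivity)]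
        refine ENNReal.ofReal_le_ofReal ?_
        have h4 : (2 : ℝ) ≤ 2 ^ α := by
          simpa using Real.rpow_le_rpow_of_exponent_le one_le_two (by linarith : 1 ≤ α)
        rw [show 4 * a = 2 * (2 * a) by ring, Real.mul_rpow two_pos.le ha0.le,
          Real.mul_rpow two_pos.le (by positivity), Real.mul_rpow two_pos.le ha0.le, hc]
        simp only [mul_inv]
        have h5 : ((2 : ℝ) ^ α)⁻¹ ≤ 1 / 2 := by
          rw [one_div]; exact inv_anti₀ two_pos h4
        have h6 : 0 ≤ ((2 : ℝ) ^ α)⁻¹ * (a ^ α)⁻¹ := by positivity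
        linarith [mul_le_mul_of_nonneg_right h5 h6]
    _ ≤ _ := lintegral_mono_set (Set.Ioo_subset_Icc_self.trans
          (Set.Icc_subset_Icc (by linarith) (by linarith)))

/-! ### Reparametrization by arclength -/

theorem Function.Periodic.deriv_periodic {V : Type*} [NormedAddCommGroup V] [NormedSpace ℝ V]
    {f : ℝ → V} {T : ℝ} (hf : Function.Periodic f T) : Function.Periodic (deriv f) T := by
  intro x
  rw [← deriv_comp_add_const, funext hf]

section LocallyIntegrable

variable {V : Type*} [NormedAddCommGroup V] {f : ℝ → V}

theorem MeasureTheory.LocallyIntegrable.intervalIntegrable (hf : LocallyIntegrable f) {a b : ℝ} :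
    IntervalIntegrable f volume a b :=
  intervalIntegrable_iff.mpr
    ((hf.integrableOn_isCompact isCompact_uIcc).mono_set Set.uIoc_subset_uIcc)

theorem MeasureTheory.LocallyIntegrable.norm (hf : LocallyIntegrable f) :
    LocallyIntegrable fun x => ‖f x‖ :=
  hf.mono hf.aestronglyMeasurable.norm (Filter.Eventually.of_forall fun x => by simp)

end LocallyIntegrable

section Lipschitz

variable {V : Type*} [NormedAddCommGroup V] [NormedSpace ℝ V] [FiniteDimensional ℝ V]
  {f : ℝ → V} {K : NNReal}

theorem LipschitzWith.locallyIntegrable_deriv (hf : LipschitzWith K f) :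
    LocallyIntegrable (deriv f) := by
  have : CompleteSpace V := FiniteDimensional.complete ℝ V
  refine (locallyIntegrable_const (K : ℝ)).mono (aestronglyMeasurable_deriv f _) ?_
  refine Filter.Eventually.of_forall fun x => ?_
  simpa using norm_deriv_le_of_lipschitz hf

/-- The difference of `f` and the primitive of its derivative is absolutely continuous with
derivative zero almost everywhere, hence constant. -/
theorem LipschitzWith.integral_deriv_eq_sub (hf : LipschitzWith K f) (a b : ℝ) :
    ∫ x in a..b, deriv f x = f b - f a := by
  have : CompleteSpace V := FiniteDimensional.complete ℝ V
  have hi := hf.locallyIntegrable_deriv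
  have hii : ∀ a b, IntervalIntegrable (deriv f) volume a b := fun a b => hi.intervalIntegrable
  have hG : LipschitzWith K fun t => ∫ x in a..t, deriv f x := by
    refine LipschitzWith.of_dist_le_mul fun s t => ?_
    rw [dist_eq_norm, intervalIntegral.integral_interval_sub_left (hii _ _) (hii _ _),
      dist_comm, Real.dist_eq, abs_sub_comm]
    refine intervalIntegral.norm_integral_le_of_norm_le_const fun x _ =>
      norm_deriv_le_of_lipschitz hf
  have hac : AbsolutelyContinuousOnInterval (fun t => f t - ∫ x in a..t, deriv f x) a b :=
    (hf.lipschitzOnWith.absolutelyContinuousOnInterval).fun_sub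
      hG.lipschitzOnWith.absolutelyContinuousOnInterval
  obtain ⟨C, hC⟩ := hac.const_of_ae_hasDerivAt_zero (by
    filter_upwards [_root_.LocallyIntegrable.ae_hasDerivAt_integral hi,
      hf.ae_differentiableAt_real] with x h1 h2 _
    simpa using h2.hasDerivAt.fun_sub (h1 a))
  have h1 := hC a Set.left_mem_uIcc
  have h2 := hC b Set.right_mem_uIcc
  rw [intervalIntegral.integral_same, sub_zero] at h1
  rw [h1, ← h2]
  abel

end Lipschitz

/-! ### Change of variables by the arclength function -/

section Speed

variable {v : ℝ → ℝ}

/-- Positivity almost everywhere makes the primitive strictly increasing; periodicity makes its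
values at integers `n` equal to `n` times a positive number, so it is unbounded in both directions
and surjective. -/
theorem exists_orderIso_integral (hi : LocallyIntegrable v) (hpos : ∀ᵐ t, 0 < v t)
    (hper : Function.Periodic v 1) :
    ∃ σ : ℝ ≃o ℝ, ∀ t, σ t = ∫ τ in (0 : ℝ)..t, v τ := by
  have hii : ∀ a b, IntervalIntegrable v volume a b := fun a b => hi.intervalIntegrable
  have hmono : StrictMono fun t => ∫ τ in (0 : ℝ)..t, v τ := by
    intro a b hab
    rw [← sub_pos, intervalIntegral.integral_interval_sub_left (hii _ _) (hii _ _),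
      intervalIntegral.integral_of_le hab.le,
      setIntegral_pos_iff_support_of_nonneg_ae
        (ae_restrict_of_ae (hpos.mono fun t ht => ht.le)) ((hii a b).1)]
    have h : volume (Set.Ioc a b) ≤ volume (Function.support v ∩ Set.Ioc a b) := by
      refine measure_mono_ae ?_
      filter_upwards [hpos] with t ht hmem using ⟨ht.ne', hmem⟩
    refine lt_of_lt_of_le ?_ h
    simpa using hab
  have hcont : Continuous fun t => ∫ τ in (0 : ℝ)..t, v τ :=
    intervalIntegral.continuous_primitive (fun a b => hii a b) 0
  have hn : ∀ n : ℤ, ∫ τ in (0 : ℝ)..n, v τ = n * ∫ τ in (0 : ℝ)..1, v τ := by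
    intro n
    have := hper.intervalIntegral_add_zsmul_eq n 0 (fun _ _ => hii _ _)
    simpa using this
  have hL : 0 < ∫ τ in (0 : ℝ)..1, v τ := by
    have := hmono (zero_lt_one' ℝ)
    simpa using this
  have hsurj : Function.Surjective fun t => ∫ τ in (0 : ℝ)..t, v τ := by
    intro y
    obtain ⟨n, hn'⟩ := exists_nat_ge (|y| / ∫ τ in (0 : ℝ)..1, v τ)
    rw [div_le_iff₀ hL] at hn'
    have h1 := hn n
    have h2 := hn (-n)
    push_cast at h1 h2
    obtain ⟨h3, h4⟩ := abs_le.mp hn'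
    have := intermediate_value_Icc (a := -(n : ℝ)) (b := n) (by linarith [n.cast_nonneg (α := ℝ)])
      hcont.continuousOn
    obtain ⟨t, -, ht⟩ := this (show y ∈ _ from ⟨by simp only [h2]; linarith,
      by simp only [h1]; linarith⟩)
    exact ⟨t, ht⟩
  exact ⟨hmono.orderIsoOfSurjective _ hsurj, fun t => rfl⟩

variable {σ : ℝ ≃o ℝ}

/-- It suffices to compare intervals, where it is the definition of `σ`. Both the substitution rule
and the transport of null sets along `σ` follow. -/
theorem map_withDensity_eq_volume (hi : LocallyIntegrable v) (h0 : ∀ t, 0 ≤ v t)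
    (hσ : ∀ t, σ t = ∫ τ in (0 : ℝ)..t, v τ) :
    (volume.withDensity fun t => ENNReal.ofReal (v t)).map σ = volume := by
  symm
  refine Measure.ext_of_Ioc _ _ fun a b hab => ?_
  have hm : Measurable σ := σ.continuous.measurable
  rw [Measure.map_apply hm measurableSet_Ioc, σ.preimage_Ioc,
    withDensity_apply _ measurableSet_Ioc,
    ← ofReal_integral_eq_lintegral_ofReal hi.intervalIntegrable.1
      (Filter.Eventually.of_forall h0),
    ← intervalIntegral.integral_of_le (σ.symm.monotone hab.le),
    ← intervalIntegral.integral_interval_sub_left (a := 0) hi.intervalIntegrable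
      hi.intervalIntegrable, ← hσ, ← hσ, Real.volume_Ioc]
  simp

theorem setLIntegral_comp_mul_speed (hi : LocallyIntegrable v) (hm : Measurable v)
    (h0 : ∀ t, 0 ≤ v t) (hσ : ∀ t, σ t = ∫ τ in (0 : ℝ)..t, v τ) (H : ℝ → ℝ≥0∞) (a b : ℝ) :
    ∫⁻ t in Set.Ioc a b, H (σ t) * ‖v t‖ₑ = ∫⁻ x in Set.Ioc (σ a) (σ b), H x := by
  have hemb : MeasurableEmbedding σ := σ.toHomeomorph.measurableEmbedding
  conv_rhs => rw [← map_withDensity_eq_volume hi h0 hσ]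
  rw [hemb.restrict_map, σ.preimage_Ioc,
    hemb.lintegral_map, restrict_withDensity measurableSet_Ioc,
    lintegral_withDensity_eq_lintegral_mul_non_measurable _ hm.ennreal_ofReal
      (Filter.Eventually.of_forall fun t => ENNReal.ofReal_lt_top)]
  simp only [OrderIso.symm_apply_apply, Pi.mul_apply]
  refine lintegral_congr fun t => ?_
  rw [mul_comm, Real.enorm_of_nonneg (h0 t)]

theorem ae_comp_symm (hi : LocallyIntegrable v) (h0 : ∀ t, 0 ≤ v t)
    (hσ : ∀ t, σ t = ∫ τ in (0 : ℝ)..t, v τ) {p : ℝ → Prop} (hp : ∀ᵐ t, p t) :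
    ∀ᵐ x, p (σ.symm x) := by
  have hemb : MeasurableEmbedding σ := σ.toHomeomorph.measurableEmbedding
  rw [← map_withDensity_eq_volume hi h0 hσ, hemb.ae_map_iff]
  simp only [OrderIso.symm_apply_apply]
  exact (withDensity_absolutelyContinuous _ _).ae_le hp

end Speed

section CircleDistance

/-- The intrinsic distance becomes the norm on the circle, which unlike the minimum on the right is
periodic in `z`. -/
theorem norm_addCircle_eq_min {L z : ℝ} (hL : 0 < L) (hz : |z| ≤ L) :
    ‖(z : AddCircle L)‖ = min |z| (L - |z|) := by
  have habs : ∀ y : ℝ, |y| ≤ L / 2 → ‖(y : AddCircle L)‖ = |y| := fun y hy => by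
    rw [AddCircle.norm_coe_eq_abs_iff L hL.ne', abs_of_pos hL]; exact hy
  rcases le_total |z| (L / 2) with h | h
  · rw [habs z h, min_eq_left (by linarith)]
  · rw [min_eq_right (by linarith)]
    rcases le_total 0 z with h0 | h0
    · rw [abs_of_nonneg h0] at h hz ⊢
      have e : ((z - L : ℝ) : AddCircle L) = z := by
        rw [AddCircle.coe_sub, AddCircle.coe_period, sub_zero]
      have h1 : |z - L| = L - z := by rw [abs_of_nonpos (by linarith)]; ring
      rw [← e, habs _ (by rw [h1]; linarith), h1]
    · rw [abs_of_nonpos h0] at h hz ⊢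
      have h1 : |z + L| = L - -z := by rw [abs_of_nonneg (by linarith)]; ring
      rw [← AddCircle.coe_add_period, habs _ (by rw [h1]; linarith), h1]

end CircleDistance

section Arclength

variable {γ : ℝ → E3}

theorem arclengthParam_eq {σ : ℝ ≃o ℝ} (hσ : ∀ t, σ t = arclength γ 0 t) :
    arclengthParam γ = γ ∘ σ.symm := by
  have h : (fun t => arclength γ 0 t) = σ := funext fun t => (hσ t).symm
  funext x
  have := Function.invFun_eq (f := σ) (b := x) (σ.surjective x)
  simp only [arclengthParam, h, Function.comp]
  rw [σ.eq_symm_apply.mpr this]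

theorem lipschitzWith_one_comp_symm {σ : ℝ ≃o ℝ} (hσ : ∀ t, σ t = arclength γ 0 t)
    {K : NNReal} (hγ : LipschitzWith K γ) : LipschitzWith 1 (γ ∘ σ.symm) := by
  refine LipschitzWith.of_dist_le_mul fun x y => ?_
  have hii : ∀ a b, IntervalIntegrable (fun t => ‖deriv γ t‖) volume a b := fun a b =>
    hγ.locallyIntegrable_deriv.norm.intervalIntegrable
  obtain ⟨s, rfl⟩ := σ.surjective x
  obtain ⟨t, rfl⟩ := σ.surjective y
  simp only [Function.comp, σ.symm_apply_apply, NNReal.coe_one, one_mul]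
  rw [dist_eq_norm, ← hγ.integral_deriv_eq_sub, Real.dist_eq, hσ, hσ, arclength, arclength,
    intervalIntegral.integral_interval_sub_left (hii _ _) (hii _ _)]
  exact intervalIntegral.norm_integral_le_abs_integral_norm

/-- At almost every point `σ` has the positive derivative `‖deriv γ‖`, so the inverse has the
reciprocal derivative and the chain rule normalizes the speed. -/
theorem ae_norm_deriv_comp_symm {σ : ℝ ≃o ℝ} (hσ : ∀ t, σ t = arclength γ 0 t)
    {K : NNReal} (hγ : LipschitzWith K γ) (hpos : ∀ᵐ t : ℝ, 0 < ‖deriv γ t‖) :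
    ∀ᵐ x : ℝ, ‖deriv (γ ∘ σ.symm) x‖ = 1 := by
  have hi := hγ.locallyIntegrable_deriv.norm
  have h := ae_comp_symm hi (fun t => norm_nonneg _) hσ
    (hpos.and (hγ.ae_differentiableAt_real.and
      (_root_.LocallyIntegrable.ae_hasDerivAt_integral hi)))
  filter_upwards [h] with x ⟨h1, h2, h3⟩
  have h4 : HasDerivAt σ ‖deriv γ (σ.symm x)‖ (σ.symm x) := by
    have e : (σ : ℝ → ℝ) = fun t => ∫ τ in (0 : ℝ)..t, ‖deriv γ τ‖ := funext hσ
    rw [e]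
    exact h3 0
  have h5 : HasDerivAt σ.symm ‖deriv γ (σ.symm x)‖⁻¹ x :=
    HasDerivAt.of_local_left_inverse σ.symm.continuous.continuousAt h4 h1.ne'
      (Filter.Eventually.of_forall σ.apply_symm_apply)
  rw [(h2.hasDerivAt.scomp x h5).deriv, norm_smul, norm_inv, norm_norm,
    inv_mul_cancel₀ h1.ne']

theorem orderIso_add_one {σ : ℝ ≃o ℝ} (hσ : ∀ t, σ t = arclength γ 0 t)
    {K : NNReal} (hγ : LipschitzWith K γ) (hper : Function.Periodic γ 1) (t : ℝ) :
    σ (t + 1) = σ t + curveLength 1 γ := by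
  have hi := hγ.locallyIntegrable_deriv.norm
  have hp : Function.Periodic (fun t => ‖deriv γ t‖) 1 := fun t => by
    simp only [hper.deriv_periodic t]
  have h := hp.intervalIntegral_add_eq t 0
  rw [← intervalIntegral.integral_interval_sub_left (a := 0) hi.intervalIntegrable
    hi.intervalIntegrable, zero_add] at h
  rw [hσ, hσ, curveLength, arclength, arclength, arclength, ← h]
  ring

theorem oharaEnergy_eq_unitSpeedEnergy {σ : ℝ ≃o ℝ} (hσ : ∀ t, σ t = arclength γ 0 t)
    {K : NNReal} (hγ : LipschitzWith K γ) (hper : Function.Periodic γ 1) (α : ℝ) :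
    oharaEnergy 1 α γ = unitSpeedEnergy (curveLength 1 γ) α (γ ∘ σ.symm) := by
  set L := curveLength 1 γ with hLdef
  set Γ := γ ∘ σ.symm with hΓ
  have hi := hγ.locallyIntegrable_deriv.norm
  have hm : Measurable fun t => ‖deriv γ t‖ := (measurable_deriv γ).norm
  have hadd := orderIso_add_one hσ hγ hper
  have hσ0 : σ 0 = 0 := by rw [hσ, arclength, intervalIntegral.integral_same]
  have hL : 0 < L := by
    have h1 := hadd 0
    rw [hσ0, zero_add, zero_add] at h1
    rw [hLdef, ← h1, ← hσ0]
    exact σ.strictMono zero_lt_one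
  have hΓper : Function.Periodic Γ L := by
    intro x
    obtain ⟨t, rfl⟩ := σ.surjective x
    rw [hΓ, hLdef, Function.comp, Function.comp, ← hadd, σ.symm_apply_apply, σ.symm_apply_apply,
      hper]
  have hΓσ : ∀ t, Γ (σ t) = γ t := fun t => by simp [hΓ]
  -- The density in terms of both arclength parameters, extended periodically in `y`, so that its
  -- integral can be taken over any window of length `L`.
  set F : ℝ → ℝ → ℝ≥0∞ := fun x y =>
    1 / ‖Γ y - Γ x‖ₑ ^ α - 1 / ENNReal.ofReal ‖((y - x : ℝ) : AddCircle L)‖ ^ α with hF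
  have hFper : ∀ x, Function.Periodic (F x) L := fun x y => by
    simp only [hF, hΓper y, add_sub_right_comm y L x, AddCircle.coe_add_period]
  have hFw : ∀ x, ∀ w ∈ Set.Icc (-(L / 2)) (L / 2),
      F x (x + w) = 1 / ‖Γ (x + w) - Γ x‖ₑ ^ α - 1 / ‖w‖ₑ ^ α := by
    intro x w hw
    rw [Set.mem_Icc, ← abs_le] at hw
    simp only [hF, add_sub_cancel_left]
    rw [norm_addCircle_eq_min hL (by linarith), min_eq_left (by linarith),
      ← Real.enorm_eq_ofReal_abs]
  have hinner : ∀ u, ∫⁻ w in Set.Icc (-1 / 2 : ℝ) (1 / 2),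
      (1 / ‖γ (u + w) - γ u‖ₑ ^ α - 1 / ENNReal.ofReal (intrinsicDist 1 γ (u + w) u) ^ α)
        * ‖deriv γ (u + w)‖ₑ * ‖deriv γ u‖ₑ =
      (∫⁻ w in Set.Icc (-(L / 2)) (L / 2), F (σ u) (σ u + w)) * ‖‖deriv γ u‖‖ₑ := by
    intro u
    rw [lintegral_mul_const' _ _ enorm_ne_top, enorm_norm]
    congr 1
    calc _ = ∫⁻ w in Set.Icc (-1 / 2 : ℝ) (1 / 2),
          F (σ u) (σ (w + u)) * ‖‖deriv γ (w + u)‖‖ₑ := by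
          refine setLIntegral_congr_fun measurableSet_Icc fun w hw => ?_
          have h1 : arclength γ u (u + w) = σ (u + w) - σ u := by
            rw [hσ, hσ, arclength, arclength, arclength,
              intervalIntegral.integral_interval_sub_left hi.intervalIntegrable
                hi.intervalIntegrable]
          have h2 : |σ (u + w) - σ u| ≤ L := by
            have e1 := hadd u
            have e2 := hadd (u - 1)
            rw [sub_add_cancel] at e2
            have e3 := σ.monotone (show u + w ≤ u + 1 by linarith [hw.2])
            have e4 := σ.monotone (show u - 1 ≤ u + w by linarith [hw.1])
            rw [abs_le]
            constructor <;> linarith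
          simp only [hF, add_comm w u, hΓσ, enorm_norm]
          rw [norm_addCircle_eq_min hL h2, intrinsicDist, h1]
      _ = ∫⁻ w in Set.Ioc (-1 / 2 : ℝ) (1 / 2),
          F (σ u) (σ (w + u)) * ‖‖deriv γ (w + u)‖‖ₑ := by rw [restrict_Ioc_eq_restrict_Icc]
      _ = ∫⁻ t in Set.Ioc (u - 1 / 2) (u + 1 / 2), F (σ u) (σ t) * ‖‖deriv γ t‖‖ₑ := by
          rw [← setLIntegral_add_right _ (Set.Ioc (u - 1 / 2) (u + 1 / 2)) u, Set.preimage_add_const_Ioc]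
          ring_nf
      _ = ∫⁻ y in Set.Ioc (σ (u - 1 / 2)) (σ (u - 1 / 2) + L), F (σ u) y := by
          rw [setLIntegral_comp_mul_speed hi hm (fun t => norm_nonneg _) hσ (F (σ u)), ← hadd]
          ring_nf
      -- The image of the window centred at `u` need not be centred at `σ u`; periodicity recentres
      -- it.
      _ = ∫⁻ y in Set.Ioc (σ u - L / 2) (σ u - L / 2 + L), F (σ u) y :=
          (hFper _).setLIntegral_Ioc_eq hL _ _
      _ = ∫⁻ w in Set.Ioc (-(L / 2)) (L / 2), F (σ u) (σ u + w) := by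
          rw [← setLIntegral_add_right _ (Set.Ioc (σ u - L / 2) _) (σ u), Set.preimage_add_const_Ioc]
          simp only [add_comm _ (σ u)]
          ring_nf
      _ = _ := by rw [restrict_Ioc_eq_restrict_Icc]
  rw [oharaEnergy]
  simp_rw [hinner]
  rw [setLIntegral_comp_mul_speed hi hm (fun t => norm_nonneg _) hσ
    (fun x => ∫⁻ w in Set.Icc (-(L / 2)) (L / 2), F x (x + w)), hσ0, unitSpeedEnergy]
  have h1 : σ 1 = L := by rw [← zero_add (1 : ℝ), hadd, hσ0, zero_add]
  rw [h1]
  refine lintegral_congr fun x => setLIntegral_congr_fun measurableSet_Icc fun w hw => ?_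
  exact hFw x w hw

end Arclength

/-! ### Regularity of curves of finite energy -/

/-- Integration by parts for absolutely continuous functions; the boundary terms cancel by
periodicity. -/
theorem integral_deriv_mul_eq_neg_of_primitive {L : ℝ} {φ G g : ℝ → ℝ} (hφ : ContDiff ℝ ∞ φ)
    (hφL : Function.Periodic φ L) (hg : LocallyIntegrable g)
    (hG : ∀ a b, ∫ x in a..b, g x = G b - G a) (hGL : Function.Periodic G L) :
    ∫ x in (0 : ℝ)..L, deriv φ x * G x = -∫ x in (0 : ℝ)..L, φ x * g x := by
  have e : G = fun x => G 0 + ∫ t in (0 : ℝ)..x, g t := by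
    funext x; rw [hG]; ring
  have hac : AbsolutelyContinuousOnInterval G 0 L := by
    rw [e]
    exact (LipschitzWith.const (G 0)).lipschitzOnWith.absolutelyContinuousOnInterval.fun_add
      (hg.intervalIntegrable.absolutelyContinuousOnInterval_intervalIntegral Set.left_mem_uIcc)
  have hφac : AbsolutelyContinuousOnInterval φ 0 L :=
    (hφ.of_le (by norm_cast)).contDiffOn.absolutelyContinuousOnInterval
  have h := hφac.integral_mul_deriv_eq_deriv_mul hac
  have h1 : ∫ x in (0 : ℝ)..L, φ x * deriv G x = ∫ x in (0 : ℝ)..L, φ x * g x := by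
    refine intervalIntegral.integral_congr_ae ?_
    filter_upwards [_root_.LocallyIntegrable.ae_hasDerivAt_integral hg] with x hx _
    rw [e, ((hx 0).const_add (G 0)).deriv]
  have h2 := hφL 0
  have h3 := hGL 0
  rw [zero_add] at h2 h3
  rw [← h1, h, h2, h3]
  ring

theorem coord_intervalIntegral {f : ℝ → E3} {a b : ℝ} (hf : IntervalIntegrable f volume a b)
    (i : Fin 3) : (∫ x in a..b, f x) i = ∫ x in a..b, f x i :=
  ((EuclideanSpace.proj i : E3 →L[ℝ] ℝ).intervalIntegral_comp_comm hf).symm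

theorem MeasureTheory.LocallyIntegrable.coord {f : ℝ → E3} (hf : LocallyIntegrable f)
    (i : Fin 3) : LocallyIntegrable fun x => f x i := by
  refine hf.norm.mono ?_ ?_
  · exact (EuclideanSpace.proj i : E3 →L[ℝ] ℝ).continuous.comp_aestronglyMeasurable
      hf.aestronglyMeasurable
  · exact Filter.Eventually.of_forall fun x => by simpa using PiLp.norm_apply_le (f x) i

theorem isPeriodicWeakDeriv_of_primitive {L : ℝ} {G g : ℝ → E3} (hg : LocallyIntegrable g)
    (hG : ∀ a b, ∫ x in a..b, g x = G b - G a) (hGc : Continuous G)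
    (hGL : Function.Periodic G L) : IsPeriodicWeakDeriv L G g := by
  intro φ hφ hφL
  have h1 : Continuous fun u => deriv φ u • G u :=
    (hφ.continuous_deriv (by norm_cast)).smul hGc
  have h2 : IntervalIntegrable (fun u => φ u • g u) volume 0 L :=
    hg.intervalIntegrable.continuousOn_smul hφ.continuous.continuousOn
  ext i
  rw [PiLp.neg_apply, coord_intervalIntegral (h1.intervalIntegrable _ _),
    coord_intervalIntegral h2]
  simp only [PiLp.smul_apply, smul_eq_mul]
  refine integral_deriv_mul_eq_neg_of_primitive hφ hφL (hg.coord i) (fun a b => ?_) fun x => by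
    rw [hGL]
  rw [← coord_intervalIntegral hg.intervalIntegrable, hG, PiLp.sub_apply]

theorem injOn_of_unitSpeedEnergy_lt_top {V : Type*} [NormedAddCommGroup V] {L α : ℝ} (hL : 0 < L)
    (hα : 2 ≤ α) {Γ : ℝ → V} (hΓ : Function.Periodic Γ L) (hlip : LipschitzWith 1 Γ)
    (hE : unitSpeedEnergy L α Γ < ⊤) : Set.InjOn Γ (Set.Ico 0 L) := by
  have key : ∀ x ∈ Set.Ico 0 L, ∀ y ∈ Set.Ico 0 L, x < y → Γ x ≠ Γ y := by
    intro x hx y hy hxy heq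
    rcases le_total (y - x) (L / 2) with h | h
    · refine ne_of_unitSpeedEnergy_lt_top hL hα hΓ hlip hE x (sub_pos.mpr hxy) h ?_
      rw [add_sub_cancel, heq]
    -- When the arc from `x` to `y` is longer than half the circle, go from `y` around to `x + L`.
    · refine ne_of_unitSpeedEnergy_lt_top hL hα hΓ hlip hE y (w₀ := x + L - y)
        (by linarith [hx.1, hy.2]) (by linarith) ?_
      rw [add_sub_cancel, hΓ, heq]
  intro x hx y hy heq
  rcases lt_trichotomy x y with h | h | h
  · exact (key x hx y hy h heq).elim
  · exact h
  · exact (key y hy x hx h heq.symm).elim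

theorem arclengthParam_regularity {α : ℝ} (hα : α ∈ Set.Ico (2 : ℝ) 3) {γ : ℝ → E3}
    (hper : Function.Periodic γ 1) {K : NNReal} (hγ : LipschitzWith K γ)
    (hpos : ∀ᵐ t : ℝ, 0 < ‖deriv γ t‖) (hE : oharaEnergy 1 α γ < ⊤) :
    Set.InjOn γ (Set.Ico 0 1) ∧
      (∀ t : ℝ, arclengthParam γ (arclength γ 0 t) = γ t) ∧
      Function.Periodic (arclengthParam γ) (curveLength 1 γ) ∧
      LipschitzWith 1 (arclengthParam γ) ∧
      (∀ᵐ x : ℝ, ‖deriv (arclengthParam γ) x‖ = 1) ∧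
      MemSobolevSlobodeckij (curveLength 1 γ) 1 ((α - 1) / 2) 2 (arclengthParam γ) ∧
      slobodeckijSeminorm (curveLength 1 γ) ((α - 1) / 2) 2 (deriv (arclengthParam γ)) ^ 2
        ≤ ENNReal.ofReal (4 ^ 3 * 2 ^ (2 - α)) * oharaEnergy 1 α γ := by
  obtain ⟨hα2, hα3⟩ := hα
  obtain ⟨σ, hσ⟩ := exists_orderIso_integral hγ.locallyIntegrable_deriv.norm hpos
    fun t => by rw [hper.deriv_periodic t]
  change ∀ t, σ t = arclength γ 0 t at hσ
  have hadd := orderIso_add_one hσ hγ hper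
  have hσ0 : σ 0 = 0 := by rw [hσ, arclength, intervalIntegral.integral_same]
  have hσ1 : σ 1 = curveLength 1 γ := by rw [hσ, curveLength]
  have hL : 0 < curveLength 1 γ := by
    rw [← hσ1, ← hσ0]
    exact σ.strictMono zero_lt_one
  have hΓσ : ∀ t, arclengthParam γ (σ t) = γ t := fun t => by simp [arclengthParam_eq hσ]
  have hlip : LipschitzWith 1 (arclengthParam γ) := by
    rw [arclengthParam_eq hσ]; exact lipschitzWith_one_comp_symm hσ hγ
  have hunit : ∀ᵐ x : ℝ, ‖deriv (arclengthParam γ) x‖ = 1 := by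
    rw [arclengthParam_eq hσ]; exact ae_norm_deriv_comp_symm hσ hγ hpos
  have hΓper : Function.Periodic (arclengthParam γ) (curveLength 1 γ) := by
    intro x
    obtain ⟨t, rfl⟩ := σ.surjective x
    rw [← hadd, hΓσ, hΓσ, hper]
  have hEeq : oharaEnergy 1 α γ = unitSpeedEnergy (curveLength 1 γ) α (arclengthParam γ) := by
    rw [arclengthParam_eq hσ]; exact oharaEnergy_eq_unitSpeedEnergy hσ hγ hper α
  have hinj := injOn_of_unitSpeedEnergy_lt_top hL hα2 hΓper hlip (hEeq ▸ hE)
  have hbound : slobodeckijSeminorm (curveLength 1 γ) ((α - 1) / 2) 2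
      (deriv (arclengthParam γ)) ^ 2 ≤
        ENNReal.ofReal (4 ^ 3 * 2 ^ (2 - α)) * oharaEnergy 1 α γ := by
    rw [slobodeckijSeminorm_sq (measurable_deriv _), hEeq]
    refine (truncSlobodeckij_le_unitSpeedEnergy hL hα2 hΓper.deriv_periodic (measurable_deriv _)
      hunit hlip.integral_deriv_eq_sub).trans ?_
    gcongr
    -- `α < 3` gives `2 ^ (2 - α) ≥ 1 / 2`, so `4 ^ 3 * 2 ^ (2 - α) ≥ 32`.
    have h := Real.rpow_le_rpow_of_exponent_le one_le_two (by linarith : (-1 : ℝ) ≤ 2 - α)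
    rw [Real.rpow_neg_one] at h
    linarith
  refine ⟨fun s hs t ht h => ?_, fun t => by rw [← hσ, hΓσ], hΓper, hlip, hunit, ?_, hbound⟩
  · refine σ.injective (hinj ?_ ?_ (by rw [hΓσ, hΓσ, h]))
    · exact ⟨hσ0 ▸ σ.monotone hs.1, hσ1 ▸ σ.strictMono hs.2⟩
    · exact ⟨hσ0 ▸ σ.monotone ht.1, hσ1 ▸ σ.strictMono ht.2⟩
  · refine ⟨fun n => if n = 0 then arclengthParam γ else deriv (arclengthParam γ), by simp, ?_, ?_,
      ?_⟩
    · intro j _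
      by_cases hj : j = 0
      · simp only [hj, if_true]
        exact ⟨hΓper, hlip.continuous.memLp_restrict_Ioc _ _ _⟩
      · simp only [hj, if_false]
        refine ⟨hΓper.deriv_periodic, MemLp.of_bound (measurable_deriv _).aestronglyMeasurable 1 ?_⟩
        exact ae_restrict_of_ae (hunit.mono fun x hx => hx.le)
    · intro j hj
      obtain rfl : j = 0 := by omega
      simpa using isPeriodicWeakDeriv_of_primitive hlip.locallyIntegrable_deriv
        hlip.integral_deriv_eq_sub hlip.continuous hΓper
    · simp only [one_ne_zero, if_false]
      have h := hbound.trans_lt (ENNReal.mul_lt_top ENNReal.ofReal_lt_top hE)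
      exact (ENNReal.pow_lt_top_iff.mp h).resolve_right two_ne_zero

/-! ### Weak derivatives -/

theorem Function.Periodic.locallyIntegrable {V : Type*} [NormedAddCommGroup V] {f : ℝ → V} {T : ℝ}
    (hf : Function.Periodic f T) (hT : 0 < T) (hi : IntegrableOn f (Set.Ioc 0 T)) :
    LocallyIntegrable f := by
  have h : IntervalIntegrable f volume 0 (0 + T) := by
    rw [zero_add, intervalIntegrable_iff_integrableOn_Ioc_of_le hT.le]; exact hi
  intro x
  refine ⟨Set.Ioc (x - 1) (x + 1), Ioc_mem_nhds (by linarith) (by linarith), ?_⟩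
  rw [← intervalIntegrable_iff_integrableOn_Ioc_of_le (by linarith)]
  exact hf.intervalIntegrable hT.ne' h _ _

/-- All Fourier coefficients except the zeroth vanish, so they are summable and the continuous
function equals its Fourier series, a constant, at every point. -/
theorem eq_const_of_integral_trig_eq_zero {h : ℝ → ℝ} (hc : Continuous h)
    (hper : Function.Periodic h 1)
    (hcos : ∀ n : ℤ, n ≠ 0 → ∫ x in (0 : ℝ)..1, Real.cos (2 * Real.pi * n * x) * h x = 0)
    (hsin : ∀ n : ℤ, n ≠ 0 → ∫ x in (0 : ℝ)..1, Real.sin (2 * Real.pi * n * x) * h x = 0) :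
    ∃ c, ∀ x, h x = c := by
  have : Fact ((0 : ℝ) < 1) := ⟨zero_lt_one⟩
  have hperC : Function.Periodic (fun x => (h x : ℂ)) 1 := fun x => by simp only [hper x]
  let H : C(AddCircle (1 : ℝ), ℂ) := ⟨hperC.lift, continuous_quot_lift _ (by fun_prop)⟩
  have hH : ∀ x : ℝ, H x = h x := fun x => rfl
  have hcoeff : ∀ n : ℤ, n ≠ 0 → fourierCoeff H n = 0 := by
    intro n hn
    rw [fourierCoeff_eq_intervalIntegral H n 0, zero_add]
    have e : ∀ x : ℝ, fourier (-n) (x : AddCircle (1 : ℝ)) • H x =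
        ((Real.cos (2 * Real.pi * n * x) * h x : ℝ) : ℂ) -
          Complex.I * ((Real.sin (2 * Real.pi * n * x) * h x : ℝ) : ℂ) := by
      intro x
      rw [fourier_coe_apply, hH, smul_eq_mul]
      have e1 : 2 * (Real.pi : ℂ) * Complex.I * ((-n : ℤ) : ℂ) * x / (1 : ℝ) =
          ((-(2 * Real.pi * n * x) : ℝ) : ℂ) * Complex.I := by push_cast; ring
      rw [e1, Complex.exp_mul_I, ← Complex.ofReal_cos, ← Complex.ofReal_sin, Real.cos_neg,
        Real.sin_neg]
      push_cast
      ring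
    simp_rw [e]
    have hi1 : Continuous fun x : ℝ => ((Real.cos (2 * Real.pi * n * x) * h x : ℝ) : ℂ) := by
      fun_prop
    have hi2 : Continuous fun x : ℝ =>
        Complex.I * ((Real.sin (2 * Real.pi * n * x) * h x : ℝ) : ℂ) := by
      fun_prop
    rw [intervalIntegral.integral_sub (hi1.intervalIntegrable _ _) (hi2.intervalIntegrable _ _),
      intervalIntegral.integral_const_mul, intervalIntegral.integral_ofReal,
      intervalIntegral.integral_ofReal, hcos n hn, hsin n hn]
    simp
  have hsum : Summable (fourierCoeff H) :=
    summable_of_ne_finset_zero (s := {0}) fun n hn => hcoeff n (by simpa using hn)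
  refine ⟨(fourierCoeff H 0).re, fun x => ?_⟩
  have h1 := has_pointwise_sum_fourier_series_of_summable hsum x
  have h2 := h1.unique (hasSum_single 0 fun n hn => by rw [hcoeff n hn, zero_smul])
  rw [hH, fourier_zero, smul_eq_mul, mul_one] at h2
  rw [← h2, Complex.ofReal_re]

theorem eq_const_of_integral_deriv_mul_eq_zero {h : ℝ → ℝ} (hc : Continuous h)
    (hper : Function.Periodic h 1)
    (hφ : ∀ φ : ℝ → ℝ, ContDiff ℝ ∞ φ → Function.Periodic φ 1 →
      ∫ x in (0 : ℝ)..1, deriv φ x * h x = 0) : ∃ c, ∀ x, h x = c := by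
  have hlin : ∀ (n : ℤ) (x : ℝ), HasDerivAt (fun x : ℝ => 2 * Real.pi * n * x)
      (2 * Real.pi * n) x := fun n x => by
    simpa using (hasDerivAt_id x).const_mul (2 * Real.pi * n)
  have hshift : ∀ (n : ℤ) (x : ℝ), 2 * Real.pi * n * (x + 1) =
      2 * Real.pi * n * x + n * (2 * Real.pi) := fun n x => by ring
  have hn0 : ∀ n : ℤ, n ≠ 0 → 2 * Real.pi * n ≠ 0 := fun n hn =>
    mul_ne_zero Real.two_pi_pos.ne' (Int.cast_ne_zero.mpr hn)
  refine eq_const_of_integral_trig_eq_zero hc hper (fun n hn => ?_) fun n hn => ?_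
  · have h1 := hφ (fun x => Real.sin (2 * Real.pi * n * x)) (by fun_prop) fun x => by
      beta_reduce
      rw [hshift, Real.sin_add_int_mul_two_pi]
    have e : ∀ x, deriv (fun x => Real.sin (2 * Real.pi * n * x)) x * h x =
        (2 * Real.pi * n) * (Real.cos (2 * Real.pi * n * x) * h x) := fun x => by
      rw [((hlin n x).sin).deriv]; ring
    simp_rw [e] at h1
    rw [intervalIntegral.integral_const_mul] at h1
    exact (mul_eq_zero.mp h1).resolve_left (hn0 n hn)
  · have h1 := hφ (fun x => Real.cos (2 * Real.pi * n * x)) (by fun_prop) fun x => by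
      beta_reduce
      rw [hshift, Real.cos_add_int_mul_two_pi]
    have e : ∀ x, deriv (fun x => Real.cos (2 * Real.pi * n * x)) x * h x =
        -(2 * Real.pi * n) * (Real.sin (2 * Real.pi * n * x) * h x) := fun x => by
      rw [((hlin n x).cos).deriv]; ring
    simp_rw [e] at h1
    rw [intervalIntegral.integral_const_mul] at h1
    exact (mul_eq_zero.mp h1).resolve_left (neg_ne_zero.mpr (hn0 n hn))

/-- The primitive `G` of `g` has the same weak derivative as `γ`, so each coordinate of `γ - G` has
weak derivative zero and is constant. -/
theorem IsPeriodicWeakDeriv.integral_eq_sub {γ g : ℝ → E3} (hc : Continuous γ)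
    (hper : Function.Periodic γ 1) (hg : LocallyIntegrable g) (hgper : Function.Periodic g 1)
    (hw : IsPeriodicWeakDeriv 1 γ g) (a b : ℝ) : ∫ x in a..b, g x = γ b - γ a := by
  have hii : ∀ a b, IntervalIntegrable g volume a b := fun a b => hg.intervalIntegrable
  set G : ℝ → E3 := fun t => ∫ x in (0 : ℝ)..t, g x with hG
  have hGsub : ∀ a b, ∫ x in a..b, g x = G b - G a := fun a b =>
    (intervalIntegral.integral_interval_sub_left (hii _ _) (hii _ _)).symm
  have hGc : Continuous G := intervalIntegral.continuous_primitive hii 0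
  -- Testing against the constant `1` shows that `g` has mean zero, which makes `G` periodic.
  have hzero : ∫ x in (0 : ℝ)..1, g x = 0 := by
    have := hw (fun _ => 1) contDiff_const fun x => rfl
    simpa using this.symm
  have hGper : Function.Periodic G 1 := fun t => by
    have h1 := hgper.intervalIntegral_add_eq t 0
    rwa [zero_add, hzero, hGsub, sub_eq_zero] at h1
  have hw' := isPeriodicWeakDeriv_of_primitive hg hGsub hGc hGper
  have hconst : ∀ i : Fin 3, ∃ c, ∀ x, (γ x - G x) i = c := by
    intro i
    have hproj : Continuous fun x => (γ x - G x) i :=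
      (EuclideanSpace.proj i : E3 →L[ℝ] ℝ).continuous.comp (hc.sub hGc)
    refine eq_const_of_integral_deriv_mul_eq_zero hproj (fun x => by rw [hper, hGper]) ?_
    intro φ hφ hφ1
    have hd : Continuous (deriv φ) := hφ.continuous_deriv (by norm_cast)
    have hd1 : Continuous fun x => deriv φ x • γ x := hd.smul hc
    have hd2 : Continuous fun x => deriv φ x • G x := hd.smul hGc
    have hd3 : Continuous fun x => deriv φ x • (γ x - G x) := hd.smul (hc.sub hGc)
    have h1 : ∫ x in (0 : ℝ)..1, deriv φ x • (γ x - G x) = 0 := by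
      simp_rw [smul_sub]
      rw [intervalIntegral.integral_sub (hd1.intervalIntegrable _ _)
        (hd2.intervalIntegrable _ _), hw φ hφ hφ1, hw' φ hφ hφ1, sub_self]
    have h2 := coord_intervalIntegral (hd3.intervalIntegrable 0 1) i
    rw [h1] at h2
    simpa using h2.symm
  choose c hc' using hconst
  have heq : ∀ x y, γ x - G x = γ y - G y := fun x y => by
    ext i; rw [hc', hc']
  rw [hGsub]
  have := heq a b
  rw [sub_eq_sub_iff_add_eq_add] at this
  rw [sub_eq_sub_iff_add_eq_add, add_comm (G b), this, add_comm]

/-! ### Continuity of the derivative -/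

theorem lintegral_sq_le_of_isProbabilityMeasure {X : Type*} [MeasurableSpace X] {μ : Measure X}
    [IsProbabilityMeasure μ] {φ : X → ℝ≥0∞} (hφ : AEMeasurable φ μ) :
    (∫⁻ x, φ x ∂μ) ^ 2 ≤ ∫⁻ x, φ x ^ 2 ∂μ := by
  have h := ENNReal.lintegral_mul_le_Lp_mul_Lq μ Real.HolderConjugate.two_two hφ
    (aemeasurable_const (b := (1 : ℝ≥0∞)))
  simp only [Pi.mul_apply, mul_one, ENNReal.one_rpow, lintegral_const, measure_univ] at h
  calc (∫⁻ x, φ x ∂μ) ^ 2 ≤ ((∫⁻ x, φ x ^ (2 : ℝ) ∂μ) ^ (1 / 2 : ℝ)) ^ 2 := by gcongr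
    _ = ∫⁻ x, φ x ^ 2 ∂μ := by
      rw [← ENNReal.rpow_natCast, ← ENNReal.rpow_mul]
      norm_num

theorem enorm_integral_sub_integral_sq_le {X V : Type*} [MeasurableSpace X] {μ : Measure X}
    [IsProbabilityMeasure μ] [NormedAddCommGroup V] [NormedSpace ℝ V] [CompleteSpace V]
    [MeasurableSpace V] [BorelSpace V] [SecondCountableTopology V] {F G : X → V}
    (hF : Integrable F μ) (hG : Integrable G μ) (hFm : Measurable F) (hGm : Measurable G) :
    ‖∫ s, F s ∂μ - ∫ t, G t ∂μ‖ₑ ^ 2 ≤ ∫⁻ s, ∫⁻ t, ‖F s - G t‖ₑ ^ 2 ∂μ ∂μ := by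
  have e1 : ∫ s, F s ∂μ - ∫ t, G t ∂μ = ∫ s, ∫ t, (F s - G t) ∂μ ∂μ := by
    have : ∀ s, ∫ t, (F s - G t) ∂μ = F s - ∫ t, G t ∂μ := fun s => by
      rw [integral_sub (integrable_const _) hG]; simp
    simp_rw [this]
    rw [integral_sub hF (integrable_const _)]
    simp
  have hm : Measurable fun s => ∫⁻ t, ‖F s - G t‖ₑ ∂μ :=
    Measurable.lintegral_prod_right' (f := fun p : X × X => ‖F p.1 - G p.2‖ₑ) (by fun_prop)
  calc ‖∫ s, F s ∂μ - ∫ t, G t ∂μ‖ₑ ^ 2 ≤ (∫⁻ s, ∫⁻ t, ‖F s - G t‖ₑ ∂μ ∂μ) ^ 2 := by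
        rw [e1]
        gcongr
        exact (enorm_integral_le_lintegral_enorm _).trans
          (lintegral_mono fun s => enorm_integral_le_lintegral_enorm _)
    _ ≤ ∫⁻ s, (∫⁻ t, ‖F s - G t‖ₑ ∂μ) ^ 2 ∂μ :=
        lintegral_sq_le_of_isProbabilityMeasure hm.aemeasurable
    _ ≤ _ := lintegral_mono fun s => lintegral_sq_le_of_isProbabilityMeasure (by fun_prop)

theorem setLIntegral_comp_affine (H : ℝ → ℝ≥0∞) (u : ℝ) {h : ℝ} (hh : 0 < h) :
    ∫⁻ s in Set.Ioc (0 : ℝ) 1, H (u + s * h) =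
      ENNReal.ofReal h⁻¹ * ∫⁻ x in Set.Ioc u (u + h), H x := by
  have h1 := lintegral_comp_mul_left (fun y => (Set.Ioc u (u + h)).indicator H (u + y)) hh.ne'
  rw [lintegral_add_left_eq_self, lintegral_indicator measurableSet_Ioc,
    abs_of_pos (inv_pos.mpr hh)] at h1
  rw [← h1, ← lintegral_indicator measurableSet_Ioc]
  refine lintegral_congr fun s => ?_
  have hiff : u + h * s ∈ Set.Ioc u (u + h) ↔ s ∈ Set.Ioc (0 : ℝ) 1 := by
    constructor
    · rintro ⟨h1, h2⟩
      exact ⟨by by_contra hs; nlinarith, by by_contra hs; nlinarith⟩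
    · rintro ⟨h1, h2⟩
      exact ⟨by nlinarith, by nlinarith⟩
  by_cases hs : s ∈ Set.Ioc (0 : ℝ) 1
  · rw [Set.indicator_of_mem hs, Set.indicator_of_mem (hiff.mpr hs), mul_comm]
  · rw [Set.indicator_of_notMem hs, Set.indicator_of_notMem (mt hiff.mp hs)]

section Quotients

variable {V : Type*} [NormedAddCommGroup V] [MeasurableSpace V] [BorelSpace V]
  [SecondCountableTopology V] {f Γ : ℝ → V} {α : ℝ}

/-- Points of the two intervals are at distance at most `h`, so the factor `h ^ α / |x - y| ^ α ≥ 1`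
can be inserted; `h ≤ 1 / 2` keeps `y - x` within the range of the seminorm. -/
theorem lintegral_sub_sq_le_truncSlobodeckij (hα : 0 ≤ α) (hm : Measurable f)
    (hper : Function.Periodic f 1) (u : ℝ) {h h' : ℝ} (hh : 0 < h) (hh' : h ≤ 1 / 2)
    (h'h : h' ≤ h) :
    ∫⁻ x in Set.Ioc u (u + h), ∫⁻ y in Set.Ioc u (u + h'), ‖f x - f y‖ₑ ^ 2 ≤
      ENNReal.ofReal (h ^ α) * truncSlobodeckij 1 α f (1 / 2) := by
  have hIper : Function.Periodic (fun x => ∫⁻ w in Set.Icc (-(1 / 2) : ℝ) (1 / 2),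
      ‖f (x + w) - f x‖ₑ ^ 2 / ‖w‖ₑ ^ α) 1 := fun x => by
    simp only [add_right_comm x 1, hper x, hper (x + _)]
  calc _ ≤ ∫⁻ x in Set.Ioc u (u + h), ENNReal.ofReal (h ^ α) *
        ∫⁻ w in Set.Icc (-(1 / 2) : ℝ) (1 / 2), ‖f (x + w) - f x‖ₑ ^ 2 / ‖w‖ₑ ^ α := by
        refine setLIntegral_mono' measurableSet_Ioc fun x hx => ?_
        rw [← setLIntegral_add_right _ (Set.Ioc u (u + h')) x, Set.preimage_add_const_Ioc,
          ← lintegral_const_mul' _ _ ENNReal.ofReal_ne_top]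
        have hsub : Set.Ioc (u - x) (u + h' - x) ⊆ Set.Icc (-(1 / 2)) (1 / 2) := fun w hw =>
          ⟨by linarith [hw.1, hx.2], by linarith [hw.2, hx.1]⟩
        refine (setLIntegral_mono' measurableSet_Ioc fun w hw => ?_).trans
          (lintegral_mono_set hsub)
        have hwh : ‖w‖ₑ ^ α ≤ ENNReal.ofReal (h ^ α) := by
          rw [← ENNReal.ofReal_rpow_of_pos hh, Real.enorm_eq_ofReal_abs]
          refine ENNReal.rpow_le_rpow (ENNReal.ofReal_le_ofReal ?_) hα
          rw [abs_le]
          exact ⟨by linarith [hw.1, hx.2], by linarith [hw.2, hx.1]⟩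
        rw [add_comm w x, ← enorm_neg (f x - _), neg_sub, ← mul_div_assoc, mul_comm,
          mul_div_assoc]
        rcases eq_or_ne w 0 with rfl | hw0
        · simp
        · have h1 : ‖w‖ₑ ^ α ≠ 0 := by
            simp [ENNReal.rpow_eq_zero_iff, hw0]
          have h2 : ‖w‖ₑ ^ α ≠ ⊤ := ENNReal.rpow_ne_top_of_nonneg hα enorm_ne_top
          conv_lhs => rw [← mul_one (‖f (x + w) - f x‖ₑ ^ 2)]
          gcongr
          rw [ENNReal.le_div_iff_mul_le (Or.inl h1) (Or.inl h2), one_mul]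
          exact hwh
    _ ≤ ∫⁻ x in Set.Ioc u (u + 1), ENNReal.ofReal (h ^ α) *
        ∫⁻ w in Set.Icc (-(1 / 2) : ℝ) (1 / 2), ‖f (x + w) - f x‖ₑ ^ 2 / ‖w‖ₑ ^ α :=
        lintegral_mono_set (Set.Ioc_subset_Ioc_right (by linarith))
    _ = _ := by
        rw [lintegral_const_mul' _ _ ENNReal.ofReal_ne_top,
          hIper.setLIntegral_Ioc_eq one_pos u 0, zero_add, lintegral_div_eq_truncSlobodeckij hm]

variable [NormedSpace ℝ V] [CompleteSpace V]

/-- Both quotients are means of `f`, so Cauchy-Schwarz bounds their squared difference by the mean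
of `‖f x - f y‖ ^ 2`. The lengths of the intervals contribute `2 / h ^ 2`, and the seminorm `h ^ α`.
-/
theorem enorm_diffQuotient_sub_sq_le (hα : 0 ≤ α) (hm : Measurable f)
    (hper : Function.Periodic f 1) (hi : LocallyIntegrable f)
    (hΓ : ∀ a b, ∫ x in a..b, f x = Γ b - Γ a) (u : ℝ) {h : ℝ} (hh : 0 < h) (hh' : h ≤ 1 / 2) :
    ‖h⁻¹ • (Γ (u + h) - Γ u) - (h / 2)⁻¹ • (Γ (u + h / 2) - Γ u)‖ₑ ^ 2 ≤
      ENNReal.ofReal (2 * h ^ (α - 2)) * truncSlobodeckij 1 α f (1 / 2) := by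
  have hq : ∀ {k : ℝ}, 0 < k → k⁻¹ • (Γ (u + k) - Γ u) =
      ∫ s in Set.Ioc (0 : ℝ) 1, f (u + s * k) := fun {k} hk => by
    rw [chord_eq_smul_integral hΓ, smul_smul, inv_mul_cancel₀ hk.ne', one_smul]
  have hint : ∀ {k : ℝ}, 0 < k →
      Integrable (fun s => f (u + s * k)) (volume.restrict (Set.Ioc 0 1)) := fun {k} hk => by
    refine ⟨(hm.comp (by fun_prop)).aestronglyMeasurable, ?_⟩
    rw [HasFiniteIntegral, setLIntegral_comp_affine (fun x => ‖f x‖ₑ) u hk]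
    refine ENNReal.mul_lt_top ENNReal.ofReal_lt_top ?_
    have h2 : IntegrableOn f (Set.Ioc u (u + k)) :=
      (hi.integrableOn_isCompact isCompact_Icc).mono_set Set.Ioc_subset_Icc_self
    exact h2.2
  have hh2 : 0 < h / 2 := half_pos hh
  rw [hq hh, hq hh2]
  calc _ ≤ ∫⁻ s in Set.Ioc (0 : ℝ) 1, ∫⁻ t in Set.Ioc (0 : ℝ) 1,
        ‖f (u + s * h) - f (u + t * (h / 2))‖ₑ ^ 2 :=
        enorm_integral_sub_integral_sq_le (hint hh) (hint hh2) (by fun_prop) (by fun_prop)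
    _ = ENNReal.ofReal h⁻¹ * (ENNReal.ofReal (h / 2)⁻¹ * ∫⁻ x in Set.Ioc u (u + h),
          ∫⁻ y in Set.Ioc u (u + h / 2), ‖f x - f y‖ₑ ^ 2) := by
        rw [← lintegral_const_mul' _ _ ENNReal.ofReal_ne_top, ← setLIntegral_comp_affine _ u hh]
        refine lintegral_congr fun s => ?_
        rw [setLIntegral_comp_affine (fun y => ‖f (u + s * h) - f y‖ₑ ^ 2) u hh2]
    _ ≤ ENNReal.ofReal h⁻¹ * (ENNReal.ofReal (h / 2)⁻¹ *
          (ENNReal.ofReal (h ^ α) * truncSlobodeckij 1 α f (1 / 2))) := by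
        gcongr
        exact lintegral_sub_sq_le_truncSlobodeckij hα hm hper u hh hh' (by linarith)
    _ = _ := by
        rw [← mul_assoc, ← mul_assoc, ← ENNReal.ofReal_mul (by positivity),
          ← ENNReal.ofReal_mul (by positivity), Real.rpow_sub hh, Real.rpow_two]
        congr 2
        field_simp

/-- Quotients at consecutive dyadic scales differ by a geometric sequence, uniformly in `u`. They
are continuous and tend to `f` pointwise, hence uniformly. -/
theorem continuous_deriv_of_truncSlobodeckij_lt_top (hα : 2 < α) (hm : Measurable f)
    (hper : Function.Periodic f 1) (hi : LocallyIntegrable f)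
    (hΓ : ∀ a b, ∫ x in a..b, f x = Γ b - Γ a) (hΓc : Continuous Γ)
    (hd : ∀ x, HasDerivAt Γ (f x) x) (hf : truncSlobodeckij 1 α f (1 / 2) < ⊤) :
    Continuous f := by
  set B := (truncSlobodeckij 1 α f (1 / 2)).toReal with hB
  have hB0 : 0 ≤ B := ENNReal.toReal_nonneg
  set h : ℕ → ℝ := fun k => (1 / 2) ^ (k + 1) with hh
  have hh0 : ∀ k, 0 < h k := fun k => by positivity
  have hh1 : ∀ k, h k ≤ 1 / 2 := fun k => by
    have := pow_le_pow_of_le_one (by norm_num : (0 : ℝ) ≤ 1 / 2) (by norm_num)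
      (Nat.le_add_left 1 k)
    rwa [pow_one] at this
  set a : ℕ → ℝ → V := fun k u => (h k)⁻¹ • (Γ (u + h k) - Γ u) with ha
  -- The square root of the factor by which `h ^ (α - 2)` shrinks when `h` is halved; `r < 1` is
  -- where `2 < α` enters.
  set r : ℝ := (1 / 2) ^ ((α - 2) / 2) with hr
  have hr0 : 0 < r := by positivity
  have hr1 : r < 1 := Real.rpow_lt_one (by norm_num) (by norm_num) (by linarith)
  have hr2 : ∀ k, h k ^ (α - 2) = (r ^ (k + 1)) ^ 2 := fun k => by
    simp only [hh]
    rw [hr, ← pow_mul, ← Real.rpow_natCast, ← Real.rpow_natCast, ← Real.rpow_mul (by norm_num),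
      ← Real.rpow_mul (by norm_num)]
    congr 1
    push_cast
    ring
  set C := Real.sqrt (2 * B) * r with hC
  have hstep : ∀ u k, dist (a k u) (a (k + 1) u) ≤ C * r ^ k := by
    intro u k
    have h1 := enorm_diffQuotient_sub_sq_le (by linarith : 0 ≤ α) hm hper hi hΓ u (hh0 k) (hh1 k)
    have e : h k / 2 = h (k + 1) := by simp only [hh]; ring
    rw [e, ← ENNReal.ofReal_toReal hf.ne, ← ENNReal.ofReal_mul (by positivity), ← hB,
      ← ofReal_norm, ← ENNReal.ofReal_pow (norm_nonneg _),
      ENNReal.ofReal_le_ofReal_iff (by positivity), ← dist_eq_norm, hr2] at h1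
    have h2 : dist (a k u) (a (k + 1) u) ^ 2 ≤ (C * r ^ k) ^ 2 := by
      refine h1.trans (le_of_eq ?_)
      rw [hC, mul_pow, mul_pow, Real.sq_sqrt (by positivity)]
      ring
    exact (sq_le_sq₀ dist_nonneg (by positivity)).mp h2
  have hht : Filter.Tendsto h Filter.atTop (nhdsWithin 0 (Set.Ioi 0)) := by
    refine tendsto_nhdsWithin_iff.mpr ⟨?_, Filter.Eventually.of_forall hh0⟩
    exact (tendsto_pow_atTop_nhds_zero_of_lt_one (by norm_num) (by norm_num)).comp
      (Filter.tendsto_add_atTop_nat 1)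
  have hlim : ∀ u, Filter.Tendsto (fun k => a k u) Filter.atTop (nhds (f u)) := fun u =>
    (hd u).tendsto_slope_zero_right.comp hht
  have hunif : TendstoUniformly a f Filter.atTop := by
    rw [Metric.tendstoUniformly_iff]
    intro ε hε
    have h1 : Filter.Tendsto (fun k => C * r ^ k / (1 - r)) Filter.atTop (nhds 0) := by
      have := ((tendsto_pow_atTop_nhds_zero_of_lt_one hr0.le hr1).const_mul C).div_const (1 - r)
      simpa using this
    filter_upwards [h1.eventually (gt_mem_nhds hε)] with k hk u
    rw [dist_comm]
    exact (dist_le_of_le_geometric_of_tendsto r C hr1 (hstep u) (hlim u) k).trans_lt hk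
  refine hunif.continuous (Filter.Eventually.frequently (Filter.Eventually.of_forall fun k => ?_))
  exact ((hΓc.comp (by fun_prop)).sub hΓc).const_smul _

end Quotients

/-! ### Finiteness of the energy -/

section Energy

theorem sub_ne_zero_of_injOn {V : Type*} {γ : ℝ → V} (hper : Function.Periodic γ 1)
    (hinj : Set.InjOn γ (Set.Ico 0 1)) {u w : ℝ} (hw : w ≠ 0) (hw' : |w| < 1) :
    γ (u + w) ≠ γ u := by
  intro heq
  have hfract : ∀ x, γ (Int.fract x) = γ x := fun x => by
    have := hper.sub_int_mul_eq (x := x) ⌊x⌋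
    rwa [mul_one] at this
  have h := hinj ⟨Int.fract_nonneg _, Int.fract_lt_one _⟩ ⟨Int.fract_nonneg _, Int.fract_lt_one _⟩
    ((hfract _).trans (heq.trans (hfract _).symm))
  obtain ⟨z, hz⟩ := Int.fract_eq_fract.mp h
  rw [add_sub_cancel_left] at hz
  rw [hz, ← Int.cast_abs] at hw'
  have hz0 : |z| < 1 := by exact_mod_cast hw'
  rw [Int.abs_lt_one_iff] at hz0
  exact hw (by rw [hz, hz0, Int.cast_zero])

/-- The ratio of chord to `|w|` extends continuously to `w = 0` as the norm `Ψ` of a mean of `f`. It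
is positive there by regularity and elsewhere by injectivity, so its minimum over a compact
rectangle serves as `m`. -/
theorem exists_bilipschitz_lower_bound {V : Type*} [NormedAddCommGroup V] [NormedSpace ℝ V]
    [CompleteSpace V] {f γ : ℝ → V} (hf : Continuous f) (hf0 : ∀ x, f x ≠ 0)
    (hγ : ∀ a b, ∫ x in a..b, f x = γ b - γ a) (hper : Function.Periodic γ 1)
    (hinj : Set.InjOn γ (Set.Ico 0 1)) :
    ∃ m : ℝ, 0 < m ∧ ∀ u ∈ Set.Icc (0 : ℝ) 1, ∀ w ∈ Set.Icc (-(1 / 2) : ℝ) (1 / 2),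
      m * |w| ≤ ‖γ (u + w) - γ u‖ := by
  set Ψ : ℝ × ℝ → ℝ := fun p => ‖∫ s in (0 : ℝ)..1, f (p.1 + s * p.2)‖ with hΨ
  have hΨc : Continuous Ψ :=
    (intervalIntegral.continuous_parametric_intervalIntegral_of_continuous'
      (f := fun (p : ℝ × ℝ) (s : ℝ) => f (p.1 + s * p.2))
      (by unfold Function.uncurry; fun_prop) 0 1).norm
  have hchord : ∀ u w, ‖γ (u + w) - γ u‖ = |w| * Ψ (u, w) := fun u w => by
    rw [chord_eq_smul_integral hγ, norm_smul, Real.norm_eq_abs, hΨ,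
      ← intervalIntegral.integral_of_le zero_le_one]
  have hK : IsCompact (Set.Icc (0 : ℝ) 1 ×ˢ Set.Icc (-(1 / 2) : ℝ) (1 / 2)) :=
    isCompact_Icc.prod isCompact_Icc
  obtain ⟨⟨u₀, w₀⟩, ⟨-, hw₀⟩, hmin⟩ := hK.exists_isMinOn ⟨(0, 0), by norm_num⟩ hΨc.continuousOn
  refine ⟨Ψ (u₀, w₀), ?_, fun u hu w hw => ?_⟩
  · rcases eq_or_ne w₀ 0 with h0 | h0
    · simpa [hΨ, h0] using hf0 u₀
    · have h1 : |w₀| < 1 := by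
        rw [abs_lt]
        exact ⟨by linarith [hw₀.1], by linarith [hw₀.2]⟩
      have h2 := norm_pos_iff.mpr (sub_ne_zero.mpr (sub_ne_zero_of_injOn hper hinj h0 h1 (u := u₀)))
      rw [hchord] at h2
      exact pos_of_mul_pos_right h2 (abs_nonneg _)
  · rw [hchord, mul_comm]
    exact mul_le_mul_of_nonneg_left (hmin ⟨hu, hw⟩) (abs_nonneg _)

theorem oharaEnergy_lt_top_of_truncSlobodeckij {α : ℝ} (hα : 1 < α) (hα' : α ≤ 4) {γ : ℝ → E3}
    (hper : Function.Periodic γ 1) (hc : Continuous (deriv γ))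
    (hγ : ∀ a b, ∫ x in a..b, deriv γ x = γ b - γ a) (h0 : ∀ t, deriv γ t ≠ 0)
    (hinj : Set.InjOn γ (Set.Ico 0 1)) (hf : truncSlobodeckij 1 α (deriv γ) (1 / 2) < ⊤) :
    oharaEnergy 1 α γ < ⊤ := by
  obtain ⟨m, hm, hlow⟩ := exists_bilipschitz_lower_bound hc h0 hγ hper hinj
  obtain ⟨M, hM⟩ := (isCompact_Icc (a := (-1 : ℝ)) (b := 2)).exists_bound_of_continuousOn
    hc.continuousOn
  have hMe : ∀ x ∈ Set.Icc (-1 : ℝ) 2, ‖deriv γ x‖ₑ ≤ ENNReal.ofReal M := fun x hx => by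
    rw [← ofReal_norm]
    exact ENNReal.ofReal_le_ofReal (hM x hx)
  set c := ENNReal.ofReal ((m ^ (α + 2))⁻¹) * ENNReal.ofReal M * ENNReal.ofReal M with hcdef
  have hctop : c ≠ ⊤ :=
    ENNReal.mul_ne_top (ENNReal.mul_ne_top ENNReal.ofReal_ne_top ENNReal.ofReal_ne_top)
      ENNReal.ofReal_ne_top
  calc oharaEnergy 1 α γ ≤ ∫⁻ u in Set.Ioc (0 : ℝ) 1, ∫⁻ w in Set.Icc (-(1 / 2) : ℝ) (1 / 2),
        c * ((∫⁻ s in Set.Ioc (0 : ℝ) 1, ∫⁻ t in Set.Ioc (0 : ℝ) 1,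
          ‖deriv γ (u + s * w) - deriv γ (u + t * w)‖ₑ ^ 2) / ‖w‖ₑ ^ α) := by
        rw [oharaEnergy, neg_div]
        refine setLIntegral_mono' measurableSet_Ioc fun u hu => ?_
        refine lintegral_mono_ae ?_
        have hne : ∀ᵐ w : ℝ ∂volume.restrict (Set.Icc (-(1 / 2) : ℝ) (1 / 2)), w ≠ 0 :=
          ae_restrict_of_ae (by simp [ae_iff])
        filter_upwards [hne, ae_restrict_mem measurableSet_Icc] with w hw hwm
        have h1 := chord_energy_density_le (by linarith) hα' hm hc hγ u hw
          (hlow u (Set.Ioc_subset_Icc_self hu) w hwm)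
          (d := intrinsicDist 1 γ (u + w) u) (min_le_left _ _)
        have h2 := hMe (u + w) ⟨by linarith [hu.1, hwm.1], by linarith [hu.2, hwm.2]⟩
        have h3 := hMe u ⟨by linarith [hu.1], by linarith [hu.2]⟩
        refine (mul_le_mul' (mul_le_mul' h1 h2) h3).trans (le_of_eq ?_)
        rw [hcdef]
        ring
    _ = c * ∫⁻ u in Set.Ioc (0 : ℝ) 1, ∫⁻ w in Set.Icc (-(1 / 2) : ℝ) (1 / 2),
        (∫⁻ s in Set.Ioc (0 : ℝ) 1, ∫⁻ t in Set.Ioc (0 : ℝ) 1,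
          ‖deriv γ (u + s * w) - deriv γ (u + t * w)‖ₑ ^ 2) / ‖w‖ₑ ^ α := by
        rw [← lintegral_const_mul' _ _ hctop]
        simp_rw [lintegral_const_mul' _ _ hctop]
    _ ≤ c * truncSlobodeckij 1 α (deriv γ) (1 / 2) := by
        rw [lintegral_segment_differences one_pos hα hper.deriv_periodic (measurable_deriv γ)]
        gcongr
        exact segment_average_le hα.le _ (by norm_num)
    _ < ⊤ := ENNReal.mul_lt_top hctop.lt_top hf

end Energy

theorem slobodeckijSeminorm_congr_ae {L s ρ : ℝ} {f g : ℝ → E3} (h : ∀ᵐ x, f x = g x) :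
    slobodeckijSeminorm L s ρ f = slobodeckijSeminorm L s ρ g := by
  unfold slobodeckijSeminorm
  congr 1
  refine lintegral_congr_ae (ae_restrict_of_ae ?_)
  filter_upwards [h] with u hu
  refine lintegral_congr_ae (ae_restrict_of_ae ?_)
  filter_upwards [(measurePreserving_add_left volume u).quasiMeasurePreserving.ae h] with w hw
  rw [hw, hu]

theorem oharaEnergy_lt_top_of_memSobolevSlobodeckij {α : ℝ} (hα : α ∈ Set.Ioo (2 : ℝ) 3)
    {γ : ℝ → E3} (hc : Continuous γ) (hγ : MemSobolevSlobodeckij 1 1 ((α - 1) / 2) 2 γ)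
    (hreg : ∀ t : ℝ, 0 < ‖deriv γ t‖) (hinj : Set.InjOn γ (Set.Ico 0 1)) :
    oharaEnergy 1 α γ < ⊤ := by
  obtain ⟨hα2, hα3⟩ := hα
  obtain ⟨D, rfl, hD, hw, hs⟩ := hγ
  have hper := (hD 0 zero_le_one).1
  obtain ⟨hgper, hg2⟩ := hD 1 le_rfl
  have hgi : IntegrableOn (D 1) (Set.Ioc 0 1) := hg2.integrable (by simp)
  have hgloc := hgper.locallyIntegrable one_pos hgi
  have hFTC := (hw 0 zero_lt_one).integral_eq_sub hc hper hgloc hgper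
  have hae : ∀ᵐ x, D 1 x = deriv (D 0) x := by
    filter_upwards [_root_.LocallyIntegrable.ae_hasDerivAt_integral hgloc] with x hx
    have e : D 0 = fun t => D 0 0 + ∫ y in (0 : ℝ)..t, D 1 y := by
      funext t; rw [hFTC]; abel
    have h1 := (hx 0).const_add (D 0 0)
    rw [← e] at h1
    exact h1.deriv.symm
  have hfloc : LocallyIntegrable (deriv (D 0)) := hgloc.congr hae
  have hFTC' : ∀ a b, ∫ x in a..b, deriv (D 0) x = D 0 b - D 0 a := fun a b => by
    rw [← hFTC]
    exact intervalIntegral.integral_congr_ae (hae.mono fun x hx _ => hx.symm)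
  have hfin : truncSlobodeckij 1 α (deriv (D 0)) (1 / 2) < ⊤ := by
    rw [← slobodeckijSeminorm_sq (measurable_deriv _), ← slobodeckijSeminorm_congr_ae hae]
    exact ENNReal.pow_lt_top hs
  have hne : ∀ t, deriv (D 0) t ≠ 0 := fun t => norm_pos_iff.mp (hreg t)
  -- Since `deriv` takes the value `0` where the curve is not differentiable, `deriv (D 0) t ≠ 0`
  -- yields differentiability at every point.
  have hcont := continuous_deriv_of_truncSlobodeckij_lt_top hα2 (measurable_deriv _)
    hper.deriv_periodic hfloc hFTC' hc
    (fun t => (differentiableAt_of_deriv_ne_zero (hne t)).hasDerivAt) hfin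
  exact oharaEnergy_lt_top_of_truncSlobodeckij (by linarith) (by linarith) hper hcont hFTC' hne
    hinj hfin

theorem theorem3p2 (α : ℝ) (hα : α ∈ Set.Ico (2 : ℝ) 3) :
    (∀ γ : ℝ → E3, Function.Periodic γ 1 → (∃ K : NNReal, LipschitzWith K γ) →
      (∀ᵐ t : ℝ, 0 < ‖deriv γ t‖) → oharaEnergy 1 α γ < ⊤ →
        Set.InjOn γ (Set.Ico 0 1) ∧
        (∀ t : ℝ, arclengthParam γ (arclength γ 0 t) = γ t) ∧
        Function.Periodic (arclengthParam γ) (curveLength 1 γ) ∧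
        LipschitzWith 1 (arclengthParam γ) ∧
        (∀ᵐ x : ℝ, ‖deriv (arclengthParam γ) x‖ = 1) ∧
        MemSobolevSlobodeckij (curveLength 1 γ) 1 ((α - 1) / 2) 2 (arclengthParam γ) ∧
        slobodeckijSeminorm (curveLength 1 γ) ((α - 1) / 2) 2 (deriv (arclengthParam γ)) ^ 2
          ≤ ENNReal.ofReal (4 ^ 3 * 2 ^ (2 - α)) * oharaEnergy 1 α γ) ∧
    (2 < α → ∀ γ : ℝ → E3, Continuous γ → MemSobolevSlobodeckij 1 1 ((α - 1) / 2) 2 γ →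
      (∀ t : ℝ, 0 < ‖deriv γ t‖) → Set.InjOn γ (Set.Ico 0 1) →
        oharaEnergy 1 α γ < ⊤) :=
  ⟨fun _ hper ⟨_, hγ⟩ hpos hE => arclengthParam_regularity hα hper hγ hpos hE,
    fun h2 _ hc hγ hreg hinj =>
      oharaEnergy_lt_top_of_memSobolevSlobodeckij ⟨h2, hα.2⟩ hc hγ hreg hinj⟩
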